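/- **Setting.** Let \(\mathfrak g\) be a complex semisimple Lie algebra with Cartan subalgebra \(\mathfrak t\), \(B\supset T\) a Borel subgroup and \(Q\supset B\) a parabolic subgroup with Levi subalgebra \(\mathfrak l\supset\mathfrak t\). Let \(P\) be the opposite parabolic, \(\sigma\) a complex involution of \(\mathfrak l\) with \(\sigma(\mathfrak t)=\mathfrak t\), and \(\mathfrak h=\mathfrak l^\sigma\oplus\mathfrak p^u\). Assume that \(\mathfrak t_s=\{h\in\mathfrak t:\sigma h=-h\}\) is a maximal toral subspace of the \((-1)\)-eigenspace of \(\sigma\), that \(\dim_{\mathbb C}\mathfrak t_s=1\) (rank one), that for each root \(\beta\) of \(B\cap L\) either \(\sigma(\beta)=\beta\) or \(-\sigma(\beta)\) is a root of \(B\cap L\), and that the set \(\Phi_s^+\) of roots of \(B\cap L\) not fixed by \(\sigma\) is non-empty (equivalently, \(L\) does not act on \(L/L\cap H\) through a torus). Let \(\Phi_{Q^u}\) be the set of roots of the unipotent radical of \(Q\), \(r=\operatorname{Card}\Phi_s^+\), \(\kappa\) the form induced on \(\mathfrak t^*\) by the Killing form of \(\mathfrak g\), and \(\chi_H=\sum_{\alpha\in\Phi_s^+\cup\Phi_{Q^u}}\frac{\alpha+\alpha\circ\sigma}{2}\).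 Let \(\mathfrak a_s\) be the real line in \(\mathfrak t_s\) on which all roots are real, and let \(\gamma\in\mathfrak t^*\) with \(\gamma\circ\sigma=-\gamma\) and \(\gamma^*\in\mathfrak a_s\) be such that \(\gamma(\gamma^*)=1\) and \(\beta(\gamma^*)\ge 0\) for \(\beta\in\Phi_s^+\) (for instance, \(\gamma\) the primitive generator of \(X^*(T/T\cap H)\) that is non-negative on the positive chamber). Set \[v(p)=\prod_{\beta\in\Phi_s^+}\kappa(\beta,p\gamma)\prod_{\alpha\in\Phi_{Q^u}}\kappa(\alpha,\chi_H-p\gamma),\qquad v_0(p)=\prod_{\beta\in\Phi_s^+}\kappa(\beta,p\gamma),\] \[J(x)=\prod_{\beta\in\Phi_s^+}\sinh(2\beta(\gamma^*)x),\qquad j=-\ln J,\qquad \lambda_{ac}=1+\sum_{\alpha\in\Phi_s^+\cup\Phi_{Q^u}}\alpha(\gamma^*).\] For \(s\ge 0\), a *Kähler–Einstein potential for \(s\)* is a smooth even function \(u:\mathbb R\to\mathbb R\) with \(u''>0\), \(u'(\mathbb R_+)=[0,\lambda_{ac}-s[\), and \(u''v(u')=e^{-(2u+j)}\) on \(]0,+\infty[\);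 it encodes a \(K\)-invariant singular Kähler–Einstein metric on the pair \((X,sD)\), where \(X\) is the toroidal compactification of the rank one horosymmetric space \(G/H\) and \(D\) its closed orbit. **Theorem.** Let \(b>0\) be such that \([0,b[\) is the set of all \(s\ge0\) for which a Kähler–Einstein potential exists, and for \(0\le s<b\) let \(u_s\) be the Kähler–Einstein potential for \(s\). Put \[\underline u_s=e^{\frac{2u_s(0)}{r+1}}\,(u_s-u_s(0)).\] Then every sequence \(s_n\in[0,b[\) with \(s_n\to b\) has a subsequence along which \(\underline u_{s_n}\) converges, locally uniformly on \(\mathbb R\), to an even \(C^2\) function \(\underline u\) that satisfies \[v_0(\underline u')\,\underline u''=C\,J\quad\text{on }\mathbb R\] for some constant \(C>0\). Moreover \(\underline u\) is the potential of a Stenzel metric (a complete, Ricci flat, \(K\)-invariant Kähler metric) on the symmetric fiber \(G_0/H_0\). In terms of potentials this means that \(\underline u\) is smooth and even, \(\underline u''>0\) (Kähler), the Ricci potential \(-\frac12\ln\Big(\underline u''(x)\prod_{\beta\in\Phi_s^+}\frac{\kappa(\beta,\underline u'(x)\gamma)}{\sinh(2\beta(\gamma^*)x)}\Big)\) is constant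 on \(]0,+\infty[\) (Ricci flat), and \(\int_0^{+\infty}\sqrt{\underline u''}\,dx=+\infty\) (complete). -/

import Mathlib

open Set Filter Topology
open LieModule (Weight)
open scoped ContDiff

noncomputable section

/-- The bilinear form induced on `𝔱*` by the Killing form of `𝔤`. It is real valued on the real span
of the roots, the only place where it is evaluated below; we record its real part. -/
def killingDual {𝔤 : Type*} [LieRing 𝔤] [LieAlgebra ℂ 𝔤] [FiniteDimensional ℂ 𝔤]
    [LieAlgebra.IsKilling ℂ 𝔤] {𝔱 : LieSubalgebra ℂ 𝔤} [𝔱.IsCartanSubalgebra]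
    (α β : Module.Dual ℂ 𝔱) : ℝ :=
  (killingForm ℂ 𝔤 ((LieAlgebra.IsKilling.cartanEquivDual 𝔱).symm α : 𝔱)
    ((LieAlgebra.IsKilling.cartanEquivDual 𝔱).symm β : 𝔱)).re

/-- A set of roots that contains every root which is a sum of two of its members. -/
def IsClosedRootSet {𝔤 : Type*} [LieRing 𝔤] [LieAlgebra ℂ 𝔤] [FiniteDimensional ℂ 𝔤]
    [LieAlgebra.IsKilling ℂ 𝔤] {𝔱 : LieSubalgebra ℂ 𝔤} [𝔱.IsCartanSubalgebra]
    (Ψ : Finset (Weight ℂ 𝔱 𝔤)) : Prop :=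
  Ψ ⊆ 𝔱.root ∧ ∀ α ∈ Ψ, ∀ β ∈ Ψ, ∀ δ ∈ 𝔱.root,
    (δ : 𝔱 →ₗ[ℂ] ℂ) = (α : 𝔱 →ₗ[ℂ] ℂ) + (β : 𝔱 →ₗ[ℂ] ℂ) → δ ∈ Ψ

/-- Infinitesimal data of a horosymmetric homogeneous space `G/H`, with `𝔤 = Lie G` semisimple and
`𝔱 = Lie T` a Cartan subalgebra: a Borel subgroup `B ⊇ T` and a parabolic subgroup `Q ⊇ B`, both given
by their roots, the common Levi subalgebra `𝔩 ⊇ 𝔱` of `Q` and of the opposite parabolic `P`,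
a complex involution `σ` of `𝔩` preserving `𝔱`, and `𝔥 = 𝔩^σ ⊕ 𝔭ᵘ`. -/
structure HorosymmetricDatum (𝔤 : Type*) [LieRing 𝔤] [LieAlgebra ℂ 𝔤] [FiniteDimensional ℂ 𝔤]
    [LieAlgebra.IsKilling ℂ 𝔤] (𝔱 : LieSubalgebra ℂ 𝔤) [𝔱.IsCartanSubalgebra] where
  /-- the roots `Φ⁺` of `B`: a system of positive roots -/
  rootsB : Finset (Weight ℂ 𝔱 𝔤)
  rootsB_closed : IsClosedRootSet rootsB
  rootsB_pos : ∀ α ∈ 𝔱.root, Xor (α ∈ rootsB) (-α ∈ rootsB)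
  /-- the roots of the parabolic subgroup `Q` -/
  rootsQ : Finset (Weight ℂ 𝔱 𝔤)
  rootsQ_closed : IsClosedRootSet rootsQ
  rootsB_subset : rootsB ⊆ rootsQ
  /-- the Levi subalgebra, with roots `α` such that `α` and `-α` are roots of `Q` -/
  𝔩 : LieSubalgebra ℂ 𝔤
  levi_eq : 𝔩.toSubmodule = 𝔱.toSubmodule ⊔
    ⨆ α ∈ {α : Weight ℂ 𝔱 𝔤 | α ∈ rootsQ ∧ -α ∈ rootsQ},
      (LieAlgebra.rootSpace 𝔱 α).toSubmodule
  torus_le : 𝔱 ≤ 𝔩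
  /-- the involution of the Levi subalgebra -/
  σ : 𝔩 ≃ₗ⁅ℂ⁆ 𝔩
  σ_invol : ∀ x, σ (σ x) = x
  σ_torus : ∀ x : 𝔩, (x : 𝔤) ∈ 𝔱 → (σ x : 𝔤) ∈ 𝔱
  /-- the isotropy subalgebra; the roots of `𝔭ᵘ` are the opposites of those of `Qᵘ` -/
  𝔥 : LieSubalgebra ℂ 𝔤
  isotropy_eq : 𝔥.toSubmodule =
    (LinearMap.ker ((σ : 𝔩 →ₗ[ℂ] 𝔩) - LinearMap.id)).map 𝔩.toSubmodule.subtype ⊔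
      ⨆ α ∈ {α : Weight ℂ 𝔱 𝔤 | α ∈ rootsQ ∧ -α ∉ rootsQ},
        (LieAlgebra.rootSpace 𝔱 (-α)).toSubmodule

namespace HorosymmetricDatum

variable {𝔤 : Type*} [LieRing 𝔤] [LieAlgebra ℂ 𝔤] [FiniteDimensional ℂ 𝔤]
  [LieAlgebra.IsKilling ℂ 𝔤] {𝔱 : LieSubalgebra ℂ 𝔤} [𝔱.IsCartanSubalgebra]
  (D : HorosymmetricDatum 𝔤 𝔱)

/-- The restriction of `σ` to `𝔱`. -/
def σT : 𝔱 →ₗ[ℂ] 𝔱 where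
  toFun h := ⟨D.σ ⟨h, D.torus_le h.2⟩, D.σ_torus _ h.2⟩
  map_add' x y := by
    apply Subtype.ext
    exact congrArg (fun z : D.𝔩 => (z : 𝔤)) (map_add D.σ ⟨x, D.torus_le x.2⟩ ⟨y, D.torus_le y.2⟩)
  map_smul' c x := by
    apply Subtype.ext
    exact congrArg (fun z : D.𝔩 => (z : 𝔤)) (map_smul D.σ c ⟨x, D.torus_le x.2⟩)

/-- The action `α ↦ α ∘ σ` on linear forms on `𝔱`. -/
def σDual (α : Module.Dual ℂ 𝔱) : Module.Dual ℂ 𝔱 := α.comp D.σT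

/-- `𝔱ₛ`, the part of `𝔱` on which `σ` acts as `-1`. -/
def splitTorus : Submodule ℂ 𝔱 := LinearMap.ker (D.σT + LinearMap.id)

open Classical in
/-- `Φ_{Qᵘ}`, the roots of the unipotent radical of `Q`. -/
def rootsQu : Finset (Weight ℂ 𝔱 𝔤) := D.rootsQ.filter fun α => -α ∉ D.rootsQ

open Classical in
/-- The roots of `B ∩ L`. -/
def rootsBL : Finset (Weight ℂ 𝔱 𝔤) := D.rootsB.filter fun α => -α ∈ D.rootsQ

open Classical in
/-- `Φₛ⁺`, the roots of `B ∩ L` that are not fixed by `σ`. -/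
def rootsS : Finset (Weight ℂ 𝔱 𝔤) :=
  D.rootsBL.filter fun β => D.σDual (β : 𝔱 →ₗ[ℂ] ℂ) ≠ (β : 𝔱 →ₗ[ℂ] ℂ)

/-- The datum is of rank one and its choices are adapted to `σ`. -/
structure IsRankOne : Prop where
  /-- `𝔱ₛ` is a maximal toral subspace of the `(-1)`-eigenspace of `σ` in `𝔩`. -/
  split_maximal : ∀ x : D.𝔩, D.σ x = -x → (LieAlgebra.ad ℂ 𝔤 (x : 𝔤)).IsSemisimple →
    (∀ h ∈ D.splitTorus, ⁅(h : 𝔤), (x : 𝔤)⁆ = 0) → (x : 𝔤) ∈ 𝔱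
  /-- The symmetric space `L/L^σ` has rank one. -/
  rank_one : Module.finrank ℂ D.splitTorus = 1
  /-- For every root `β` of `B ∩ L`, either `σ(β) = β` or `-σ(β)` is a root of `B ∩ L`. -/
  borel_adapted : ∀ β ∈ D.rootsBL, D.σDual (β : 𝔱 →ₗ[ℂ] ℂ) = (β : 𝔱 →ₗ[ℂ] ℂ) ∨
    ∃ β' ∈ D.rootsBL, (β' : 𝔱 →ₗ[ℂ] ℂ) = -D.σDual (β : 𝔱 →ₗ[ℂ] ℂ)
  /-- The action of `L` on `L/L ∩ H` does not factor through a torus: by maximality of `𝔱ₛ`, `σ`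
  is trivial on `[𝔩, 𝔩]` exactly when it fixes all roots of `𝔩`. -/
  not_toral : D.rootsS.Nonempty

/-- `γ` is a linear form on `𝔱` vanishing on `𝔱^σ`, and `γs` is the element `γ*` of the positive
restricted Weyl chamber `𝔞ₛ⁺` with `γ(γ*) = 1`. Here `𝔞ₛ` is the real form of `𝔱ₛ` on which all
roots are real. No lattice normalization of `γ` is imposed. -/
structure IsRestrictedGenerator (γ : Module.Dual ℂ 𝔱) (γs : 𝔱) : Prop where
  anti : D.σDual γ = -γ
  mem_split : γs ∈ D.splitTorus
  real : ∀ α ∈ 𝔱.root, (α γs).im = 0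
  chamber : ∀ β ∈ D.rootsS, 0 ≤ (β γs).re
  pairing : γ γs = 1

open Classical in
/-- `χ_H`, the `σ`-invariant part of the sum of the roots in `Φₛ⁺ ∪ Φ_{Qᵘ}`. -/
def chiH : Module.Dual ℂ 𝔱 :=
  ∑ α ∈ D.rootsS ∪ D.rootsQu,
    (1 / 2 : ℂ) • ((α : 𝔱 →ₗ[ℂ] ℂ) + D.σDual (α : 𝔱 →ₗ[ℂ] ℂ))

/-- `v₀(p) = ∏_{β ∈ Φₛ⁺} κ(β, pγ)`. -/
def v₀ (γ : Module.Dual ℂ 𝔱) (p : ℝ) : ℝ :=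
  ∏ β ∈ D.rootsS, killingDual (β : 𝔱 →ₗ[ℂ] ℂ) ((p : ℂ) • γ)

/-- `v(p) = ∏_{β ∈ Φₛ⁺} κ(β, pγ) ∏_{α ∈ Φ_{Qᵘ}} κ(α, χ_H - pγ)`. -/
def v (γ : Module.Dual ℂ 𝔱) (p : ℝ) : ℝ :=
  (∏ β ∈ D.rootsS, killingDual (β : 𝔱 →ₗ[ℂ] ℂ) ((p : ℂ) • γ)) *
    ∏ α ∈ D.rootsQu, killingDual (α : 𝔱 →ₗ[ℂ] ℂ) (D.chiH - (p : ℂ) • γ)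

/-- `J(x) = ∏_{β ∈ Φₛ⁺} sinh(2 β(γ*) x)`. -/
def J (γs : 𝔱) (x : ℝ) : ℝ := ∏ β ∈ D.rootsS, Real.sinh (2 * (β γs).re * x)

/-- `j = -ln J`. -/
def j (γs : 𝔱) (x : ℝ) : ℝ := -Real.log (D.J γs x)

open Classical in
/-- `λ_ac = 1 + ∑_{α ∈ Φₛ⁺ ∪ Φ_{Qᵘ}} α(γ*)`. -/
def lambdaAc (γs : 𝔱) : ℝ := 1 + ∑ α ∈ D.rootsS ∪ D.rootsQu, (α γs).re

/-- `r = Card Φₛ⁺`. -/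
def r : ℕ := D.rootsS.card

/-- `u` is the potential of a `K`-invariant singular Kähler-Einstein metric on the pair `(X, sD)`:
a smooth, even function on `ℝ` with `u'' > 0`, `u'(ℝ₊) = [0, λ_ac - s[`, and
`u'' v(u') = exp(-(2u + j))` on `]0, ∞[`. -/
structure IsKEPotential (γ : Module.Dual ℂ 𝔱) (γs : 𝔱) (s : ℝ) (u : ℝ → ℝ) : Prop where
  smooth : ContDiff ℝ ∞ u
  even : ∀ x, u (-x) = u x
  convex : ∀ x, 0 < deriv (deriv u) x
  image : deriv u '' Ici 0 = Ico 0 (D.lambdaAc γs - s)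
  ode : ∀ x, 0 < x → deriv (deriv u) x * D.v γ (deriv u x) = Real.exp (-(2 * u x + D.j γs x))

/-- `ū = e^{2u(0)/(r+1)} (u - u(0))`. -/
def rescale (u : ℝ → ℝ) (x : ℝ) : ℝ :=
  Real.exp (2 * u 0 / ((D.r : ℝ) + 1)) * (u x - u 0)

/-- On the symmetric fiber `G₀/H₀`, whose restricted roots are those of `Φₛ⁺`: the potential on
`]0, ∞[`, up to an additive constant, of the Ricci form of the `K`-invariant Kähler metric with
potential `u`. -/
def fiberRicciPotential (γ : Module.Dual ℂ 𝔱) (γs : 𝔱) (u : ℝ → ℝ) (x : ℝ) : ℝ :=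
  -(1 / 2) * Real.log (deriv (deriv u) x *
    ∏ β ∈ D.rootsS, killingDual (β : 𝔱 →ₗ[ℂ] ℂ) (((deriv u x : ℝ) : ℂ) • γ) /
      Real.sinh (2 * (β γs).re * x))

/-- `u` is the potential of a Stenzel metric on the symmetric fiber `G₀/H₀`, that is, of a complete,
Ricci flat, `K`-invariant Kähler metric: a smooth even function on the line `𝔞ₛ`, which defines
a Kähler form (`u'' > 0`), whose Ricci form vanishes (its potential is constant), and which is
complete (the rays of `𝔞ₛ`, orthogonal to the `K`-orbits, have infinite length). -/
structure IsStenzelPotential (γ : Module.Dual ℂ 𝔱) (γs : 𝔱) (u : ℝ → ℝ) : Prop where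
  smooth : ContDiff ℝ ∞ u
  even : ∀ x, u (-x) = u x
  kaehler : ∀ x, 0 < deriv (deriv u) x
  ricci_flat : ∃ c : ℝ, ∀ x, 0 < x → D.fiberRicciPotential γ γs u x = c
  complete : Tendsto (fun R : ℝ => ∫ x in (0 : ℝ)..R, Real.sqrt (deriv (deriv u) x)) atTop atTop

end HorosymmetricDatum

end

/-!
The proof reduces to an ordinary differential equation, and then analyses a blow-up.

Let `r = Card Φₛ⁺ ≥ 1`. The density factors as `v(p) = pʳ N(p)`, with `N` continuous, and
`J(x) = xʳ h(x)` with `h` smooth, even and positive. The existence of a potential for `s = 0`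
implies `v > 0` on the open moment interval and `N(0) > 0`: otherwise no solution could be
smooth with `u''(0) > 0` (`IsPotential.core_pos`). The only input from Lie theory, besides
`β(γ*) > 0`, is `κ(β, γ) > 0` for `β ∈ Φₛ⁺` (`IsRankOne.killingDual_pos`). The form `κ` need not be
invariant under `σ`, but `γ` is a positive multiple of `β + β'` with `β' = -β ∘ σ`, and `σ` maps
coroots to coroots, so that `β` and `β'` have equal Cartan integers. If these do not vanish, then
`β` and `β'` have the same length, and `κ(β, β + β')` is half of the squared length of `β + β'`.

First, `u_s(0) → ∞` as `s → b` (`tendsto_apply_zero_atTop`). Otherwise a subsequence of the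
potentials, which are convex and uniformly Lipschitz, converges to a function `w`, and the first
integral `∫₀^{u'(x)} v = ∫₀ˣ e^{-2u} J` passes to the limit. The equation degenerates at the origin;
regularity of `w` there, in particular the smoothness of its even extension, follows from the
comparison with a given potential `u₀` through `w' = u₀'(z)`: the function `z` solves
`Θ₀(z) = Θ(x)` with odd functions `Θ₀`, `Θ` of positive derivative (`smooth_of_subgradient`). The
derivative of `w` fills `[0, λ_ac - b[` because the densities `e^{-2u} J` are log-concave, which
prevents mass from escaping to infinity (`exists_tail_le`). So `w` would be a potential for
`s = b`, which is excluded.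

Secondly, the rescaled potentials satisfy
`(ū' ^ (r + 1))' N(u') = (r + 1) e^{-2(u - u(0))} J`. As `u(0) → ∞` both `u'` and `u - u(0)` tend to
zero locally uniformly, so that the equation tends to `N(0) (w' ^ (r + 1))' = (r + 1) J`
(`tendstoLocallyUniformly_blowup`). The full family converges, to the explicit solution `w`.
It is smooth, since `w'` is `x` times a root of a smooth positive function, Ricci flat by
the equation, and complete since `J' ≥ B J`, with `B = ∑ 2 β(γ*) > 0`, bounds `w''` from below at
infinity.
-/

noncomputable section

namespace HorosymmetricDatum

/-! ### Roots and the Killing form -/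

section Lie

open LieAlgebra LieAlgebra.IsKilling
open LieModule (chainBotCoeff chainTopCoeff)

variable {𝔤 : Type*} [LieRing 𝔤] [LieAlgebra ℂ 𝔤] [FiniteDimensional ℂ 𝔤]
  [LieAlgebra.IsKilling ℂ 𝔤] {𝔱 : LieSubalgebra ℂ 𝔤} [𝔱.IsCartanSubalgebra]

theorem killingForm_coe_eq_sum (x y : 𝔱) :
    killingForm ℂ 𝔤 (x : 𝔤) (y : 𝔤) = ∑ α ∈ 𝔱.root, α x * α y := by
  have h := congrArg (fun B => B x y) (restrict_killingForm_eq_sum (K := ℂ) (H := 𝔱))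
  simp only [LinearMap.sum_apply, LinearMap.smulRight_apply, LinearMap.smul_apply, smul_eq_mul] at h
  exact h

theorem killingForm_cartanEquivDual_symm (f : Module.Dual ℂ 𝔱) (x : 𝔱) :
    killingForm ℂ 𝔤 ((cartanEquivDual 𝔱).symm f : 𝔱) (x : 𝔤) = f x := by
  have h : cartanEquivDual 𝔱 ((cartanEquivDual 𝔱).symm f) x = f x := by
    rw [LinearEquiv.apply_symm_apply]
  exact h

theorem killingDual_eq (f g : Module.Dual ℂ 𝔱) :
    killingDual f g = (f ((cartanEquivDual 𝔱).symm g)).re := by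
  rw [killingDual, killingForm_cartanEquivDual_symm]

theorem apply_cartanEquivDual_symm_comm (f g : Module.Dual ℂ 𝔱) :
    f ((cartanEquivDual 𝔱).symm g) = g ((cartanEquivDual 𝔱).symm f) := by
  rw [← killingForm_cartanEquivDual_symm, ← killingForm_cartanEquivDual_symm (f := g),
    LieModule.traceForm_comm]

theorem cartanEquivDual_symm_root {β : Weight ℂ 𝔱 𝔤} (hβ : β.IsNonZero) :
    (cartanEquivDual 𝔱).symm (β : 𝔱 →ₗ[ℂ] ℂ) =
      (β ((cartanEquivDual 𝔱).symm (β : 𝔱 →ₗ[ℂ] ℂ)) / 2) • coroot β := by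
  have h := root_apply_cartanEquivDual_symm_ne_zero hβ
  rw [coroot, ← Nat.cast_smul_eq_nsmul ℂ, smul_smul, smul_smul]
  have : β ((cartanEquivDual 𝔱).symm (β : 𝔱 →ₗ[ℂ] ℂ)) / 2 *
      (((2 : ℕ) : ℂ) * (β ((cartanEquivDual 𝔱).symm (β : 𝔱 →ₗ[ℂ] ℂ)))⁻¹) = 1 := by
    field_simp
    norm_num
  rw [mul_assoc, this, one_smul]

/-- The squared length of a root is a positive real number, as the Killing form is a sum of squares
of real numbers on a coroot. -/
theorem exists_root_sq_eq {β : Weight ℂ 𝔱 𝔤} (hβ : β.IsNonZero) :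
    ∃ t : ℝ, 0 < t ∧ β ((cartanEquivDual 𝔱).symm (β : 𝔱 →ₗ[ℂ] ℂ)) = t := by
  set τ := β ((cartanEquivDual 𝔱).symm (β : 𝔱 →ₗ[ℂ] ℂ)) with hτ
  have hτ0 : τ ≠ 0 := root_apply_cartanEquivDual_symm_ne_zero hβ
  have h1 : τ / 2 * killingForm ℂ 𝔤 (coroot β : 𝔱) (coroot β : 𝔱) = 2 := by
    have := killingForm_cartanEquivDual_symm (β : 𝔱 →ₗ[ℂ] ℂ) (coroot β)
    rw [cartanEquivDual_symm_root hβ] at this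
    simpa [root_apply_coroot hβ] using this
  obtain ⟨n, hn⟩ : ∃ n : ℝ, 0 ≤ n ∧ killingForm ℂ 𝔤 (coroot β : 𝔱) (coroot β : 𝔱) = n := by
    refine ⟨∑ α ∈ 𝔱.root, ((chainBotCoeff β α - chainTopCoeff β α : ℤ) : ℝ) ^ 2,
      Finset.sum_nonneg fun _ _ => sq_nonneg _, ?_⟩
    rw [killingForm_coe_eq_sum]
    push_cast
    refine Finset.sum_congr rfl fun α _ => ?_
    rw [apply_coroot_eq_cast]
    push_cast
    ring
  rw [hn.2] at h1
  have hn0 : (n : ℂ) ≠ 0 := by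
    intro h
    simp [h] at h1
  have hn0' : 0 < n := lt_of_le_of_ne hn.1 fun h => hn0 (by simp [← h])
  refine ⟨4 / n, by positivity, ?_⟩
  push_cast
  rw [eq_div_iff hn0]
  linear_combination 2 * h1

/-- Two roots with equal Cartan integers, not opposite to each other, form angles less than `π/2`
with their sum. -/
theorem killingDual_add_pos {β β' : Weight ℂ 𝔱 𝔤} (hβ : β.IsNonZero) (hβ' : β'.IsNonZero)
    (hsymm : β (coroot β') = β' (coroot β))
    (hne : (β : 𝔱 →ₗ[ℂ] ℂ) + (β' : 𝔱 →ₗ[ℂ] ℂ) ≠ 0) :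
    0 < killingDual (β : 𝔱 →ₗ[ℂ] ℂ) ((β : 𝔱 →ₗ[ℂ] ℂ) + (β' : 𝔱 →ₗ[ℂ] ℂ)) := by
  obtain ⟨t, ht, htβ⟩ := exists_root_sq_eq hβ
  obtain ⟨t', ht', htβ'⟩ := exists_root_sq_eq hβ'
  have htc : (t : ℂ) ≠ 0 := by exact_mod_cast ht.ne'
  obtain ⟨m, hm⟩ : ∃ m : ℝ, β (coroot β') = m := by
    refine ⟨((chainBotCoeff β' β - chainTopCoeff β' β : ℤ) : ℝ), ?_⟩
    rw [apply_coroot_eq_cast]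
    push_cast
    ring
  have hs := cartanEquivDual_symm_root hβ
  have hs' := cartanEquivDual_symm_root hβ'
  rw [htβ] at hs
  rw [htβ'] at hs'
  have h1 : β ((cartanEquivDual 𝔱).symm (β' : 𝔱 →ₗ[ℂ] ℂ)) = t' / 2 * m := by
    rw [hs', ← hm]
    exact (β : 𝔱 →ₗ[ℂ] ℂ).map_smul ((t' : ℂ) / 2) (coroot β')
  have h2 : β' ((cartanEquivDual 𝔱).symm (β : 𝔱 →ₗ[ℂ] ℂ)) = t / 2 * m := by
    rw [hs, ← hm, hsymm]
    exact (β' : 𝔱 →ₗ[ℂ] ℂ).map_smul ((t : ℂ) / 2) (coroot β)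
  have h3 : t' * m = t * m := by
    have := apply_cartanEquivDual_symm_comm (β : 𝔱 →ₗ[ℂ] ℂ) (β' : 𝔱 →ₗ[ℂ] ℂ)
    simp only [Weight.toLinear_apply] at this
    rw [h1, h2] at this
    have h' : ((t' * m : ℝ) : ℂ) = ((t * m : ℝ) : ℂ) := by
      push_cast
      linear_combination 2 * this
    exact_mod_cast h'
  have hval : killingDual (β : 𝔱 →ₗ[ℂ] ℂ) ((β : 𝔱 →ₗ[ℂ] ℂ) + (β' : 𝔱 →ₗ[ℂ] ℂ)) =
      t + t' / 2 * m := by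
    rw [killingDual_eq, map_add, map_add]
    simp only [Weight.toLinear_apply]
    rw [htβ, h1]
    have : ((t : ℂ) + t' / 2 * m) = ((t + t' / 2 * m : ℝ) : ℂ) := by push_cast; ring
    rw [this, Complex.ofReal_re]
  rw [hval]
  rcases eq_or_ne m 0 with rfl | hm0
  · simpa using ht
  obtain rfl : t' = t := mul_right_cancel₀ hm0 h3
  -- The Killing form on the sum of the coroots is a sum of squares, equal to `8 / t * (1 + m / 2)`.
  set X : 𝔱 := coroot β + coroot β' with hX
  have hXf (y : 𝔱) : killingForm ℂ 𝔤 (X : 𝔤) (y : 𝔤) = 2 / t' * (β y + β' y) := by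
    have e : (X : 𝔱) = ((2 : ℂ) / t') • ((cartanEquivDual 𝔱).symm
        ((β : 𝔱 →ₗ[ℂ] ℂ) + (β' : 𝔱 →ₗ[ℂ] ℂ))) := by
      rw [map_add, hs, hs', ← smul_add, smul_smul]
      have : (2 : ℂ) / t' * (t' / 2) = 1 := by field_simp
      rw [this, one_smul]
    have h := killingForm_cartanEquivDual_symm ((β : 𝔱 →ₗ[ℂ] ℂ) + (β' : 𝔱 →ₗ[ℂ] ℂ)) y
    rw [e, show ((((2 : ℂ) / t') • ((cartanEquivDual 𝔱).symm ((β : 𝔱 →ₗ[ℂ] ℂ) +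
      (β' : 𝔱 →ₗ[ℂ] ℂ))) : 𝔱) : 𝔤) = ((2 : ℂ) / t') • (((cartanEquivDual 𝔱).symm
      ((β : 𝔱 →ₗ[ℂ] ℂ) + (β' : 𝔱 →ₗ[ℂ] ℂ)) : 𝔱) : 𝔤) from rfl, map_smul, LinearMap.smul_apply, h]
    simp
  set ν : Weight ℂ 𝔱 𝔤 → ℝ := fun α => ((chainBotCoeff β α - chainTopCoeff β α : ℤ) : ℝ) +
    ((chainBotCoeff β' α - chainTopCoeff β' α : ℤ) : ℝ) with hν
  have hνX (α : Weight ℂ 𝔱 𝔤) : α X = ν α := by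
    have : α X = α (coroot β) + α (coroot β') :=
      (α : 𝔱 →ₗ[ℂ] ℂ).map_add (coroot β) (coroot β')
    rw [this, apply_coroot_eq_cast, apply_coroot_eq_cast, hν]
    push_cast
    ring
  have hsum : ∑ α ∈ 𝔱.root, ν α ^ 2 = 8 / t' * (1 + m / 2) := by
    have h := hXf X
    rw [killingForm_coe_eq_sum] at h
    have e1 : β X = 2 + m := by
      rw [← hm, ← root_apply_coroot hβ]
      exact (β : 𝔱 →ₗ[ℂ] ℂ).map_add (coroot β) (coroot β')
    have e2 : β' X = m + 2 := by
      rw [← hm, ← root_apply_coroot hβ', hsymm]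
      exact (β' : 𝔱 →ₗ[ℂ] ℂ).map_add (coroot β) (coroot β')
    rw [e1, e2] at h
    have h' : ((∑ α ∈ 𝔱.root, ν α ^ 2 : ℝ) : ℂ) = ((8 / t' * (1 + m / 2) : ℝ) : ℂ) := by
      push_cast
      rw [show (8 : ℂ) / t' * (1 + m / 2) = 2 / t' * (2 + m + (m + 2)) by ring, ← h]
      exact Finset.sum_congr rfl fun α _ => by rw [hνX]; ring
    exact_mod_cast h'
  have hpos : 0 < ∑ α ∈ 𝔱.root, ν α ^ 2 := by
    refine lt_of_le_of_ne (Finset.sum_nonneg fun _ _ => sq_nonneg _) fun h0 => hne ?_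
    have hz := (Finset.sum_eq_zero_iff_of_nonneg fun α _ => sq_nonneg (ν α)).1 h0.symm
    ext y
    have h := hXf y
    rw [killingForm_coe_eq_sum, Finset.sum_eq_zero] at h
    · have := (mul_eq_zero.1 h.symm).resolve_left (div_ne_zero two_ne_zero htc)
      simpa using this
    · intro α hα
      rw [hνX, pow_eq_zero_iff two_ne_zero |>.1 (hz α hα)]
      simp
  rw [hsum] at hpos
  have : 0 < 1 + m / 2 := pos_of_mul_pos_right hpos (by positivity)
  nlinarith

end Lie

/-! ### The involution on the roots -/

section Datum

open LieAlgebra LieAlgebra.IsKilling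

variable {𝔤 : Type*} [LieRing 𝔤] [LieAlgebra ℂ 𝔤] [FiniteDimensional ℂ 𝔤]
  [LieAlgebra.IsKilling ℂ 𝔤] {𝔱 : LieSubalgebra ℂ 𝔤} [𝔱.IsCartanSubalgebra]
  {D : HorosymmetricDatum 𝔤 𝔱} {γ : Module.Dual ℂ 𝔱} {γs : 𝔱}

theorem σT_σT (h : 𝔱) : D.σT (D.σT h) = h := by
  apply Subtype.ext
  exact congrArg (fun z : D.𝔩 => (z : 𝔤)) (D.σ_invol ⟨h, D.torus_le h.2⟩)

theorem mem_rootsS {β : Weight ℂ 𝔱 𝔤} : β ∈ D.rootsS ↔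
    β ∈ D.rootsBL ∧ D.σDual (β : 𝔱 →ₗ[ℂ] ℂ) ≠ (β : 𝔱 →ₗ[ℂ] ℂ) := by
  simp [rootsS]

theorem mem_rootsBL {β : Weight ℂ 𝔱 𝔤} : β ∈ D.rootsBL ↔ β ∈ D.rootsB ∧ -β ∈ D.rootsQ := by
  simp [rootsBL]

theorem isNonZero_of_mem_rootsBL {β : Weight ℂ 𝔱 𝔤} (hβ : β ∈ D.rootsBL) : β.IsNonZero := by
  simpa using D.rootsB_closed.1 (mem_rootsBL.1 hβ).1

theorem rootSpace_le_levi {β : Weight ℂ 𝔱 𝔤} (hβ : β ∈ D.rootsQ) (hβ' : -β ∈ D.rootsQ) {x : 𝔤}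
    (hx : x ∈ rootSpace 𝔱 β) : x ∈ D.𝔩 := by
  have : x ∈ D.𝔩.toSubmodule := by
    rw [D.levi_eq]
    refine Submodule.mem_sup_right ?_
    refine Submodule.mem_iSup_of_mem β ?_
    refine Submodule.mem_iSup_of_mem ⟨hβ, hβ'⟩ ?_
    exact hx
  exact this

theorem σ_mem_rootSpace {χ : 𝔱 → ℂ} {x : D.𝔩} (hx : (x : 𝔤) ∈ rootSpace 𝔱 χ) :
    (D.σ x : 𝔤) ∈ rootSpace 𝔱 (χ ∘ D.σT) := by
  rw [rootSpace, LieModule.mem_genWeightSpace]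
  intro h
  refine ⟨1, ?_⟩
  have h1 : ⁅D.σT h, (x : 𝔤)⁆ = χ (D.σT h) • (x : 𝔤) := lie_eq_smul_of_mem_rootSpace hx _
  have h2 : ⁅(⟨D.σT h, D.torus_le (D.σT h).2⟩ : D.𝔩), x⁆ = χ (D.σT h) • x := Subtype.ext h1
  have h3 := congrArg (fun z => (D.σ z : 𝔤)) h2
  simp only [LieEquiv.map_lie, map_smul] at h3
  have h4 : (D.σ ⟨D.σT h, D.torus_le (D.σT h).2⟩ : 𝔤) = h :=
    congrArg (fun z : D.𝔩 => (z : 𝔤)) (D.σ_invol ⟨h, D.torus_le h.2⟩)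
  have h5 : ⁅(h : 𝔤), (D.σ x : 𝔤)⁆ = χ (D.σT h) • (D.σ x : 𝔤) := by
    rw [← h4]
    exact h3
  simp only [pow_one, LinearMap.sub_apply, LieModule.toEnd_apply_apply, LinearMap.smul_apply,
    Function.comp_apply]
  rw [sub_eq_zero]
  exact h5

/-- `σ` maps coroots of the Levi subalgebra to coroots. -/
theorem σT_coroot {β β' : Weight ℂ 𝔱 𝔤} (hβ : β ∈ D.rootsBL)
    (h : (β' : 𝔱 →ₗ[ℂ] ℂ) = -D.σDual (β : 𝔱 →ₗ[ℂ] ℂ)) (hβ' : β'.IsNonZero) :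
    D.σT (coroot β) = -coroot β' := by
  have hβ0 := isNonZero_of_mem_rootsBL hβ
  have hQ : β ∈ D.rootsQ := D.rootsB_subset (mem_rootsBL.1 hβ).1
  have hQ' : -β ∈ D.rootsQ := (mem_rootsBL.1 hβ).2
  obtain ⟨h0, e, f, ht, he, hf⟩ := exists_isSl2Triple_of_weight_isNonZero hβ0
  have hco := ht.h_eq_coroot hβ0 he hf
  have hel : e ∈ D.𝔩 := rootSpace_le_levi hQ hQ' he
  have hfl : f ∈ D.𝔩 := rootSpace_le_levi hQ' (by simpa using hQ) (by simpa using hf)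
  have hval (x : 𝔱) : β' x = -β (D.σT x) := by
    have := congrArg (fun φ => φ x) h
    simpa [σDual] using this
  have hE : (D.σ ⟨e, hel⟩ : 𝔤) ∈ rootSpace 𝔱 (-β' : Weight ℂ 𝔱 𝔤) := by
    have := σ_mem_rootSpace (D := D) (x := ⟨e, hel⟩) he
    convert this using 2
    ext x
    simp [hval]
  have hF : (D.σ ⟨f, hfl⟩ : 𝔤) ∈ rootSpace 𝔱 (-(-β' : Weight ℂ 𝔱 𝔤) : 𝔱 → ℂ) := by
    have := σ_mem_rootSpace (D := D) (x := ⟨f, hfl⟩) hf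
    convert this using 2
    ext x
    simp [hval]
  have h0l : h0 ∈ D.𝔩 := by
    rw [hco]
    exact D.torus_le (coroot β).2
  have hinj : Function.Injective D.σ := D.σ.injective
  have htriple : IsSl2Triple (D.σ ⟨h0, h0l⟩ : 𝔤) (D.σ ⟨e, hel⟩ : 𝔤) (D.σ ⟨f, hfl⟩ : 𝔤) := by
    have key (a b c : D.𝔩) (habc : ⁅(a : 𝔤), (b : 𝔤)⁆ = c) :
        ⁅(D.σ a : 𝔤), (D.σ b : 𝔤)⁆ = D.σ c := by
      have : ⁅a, b⁆ = c := Subtype.ext habc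
      rw [← this, LieEquiv.map_lie]
      rfl
    refine ⟨?_, key _ _ _ ht.lie_e_f, ?_, ?_⟩
    · intro hz
      have hz' : D.σ ⟨h0, h0l⟩ = 0 := Subtype.ext hz
      rw [← map_zero D.σ] at hz'
      exact ht.h_ne_zero (congrArg (fun z : D.𝔩 => (z : 𝔤)) (hinj hz'))
    · rw [key ⟨h0, h0l⟩ ⟨e, hel⟩ (2 • ⟨e, hel⟩) ht.lie_h_e_nsmul, map_nsmul]
      rfl
    · rw [key ⟨h0, h0l⟩ ⟨f, hfl⟩ (-(2 • ⟨f, hfl⟩)) ht.lie_h_f_nsmul, map_neg, map_nsmul]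
      rfl
  have := htriple.h_eq_coroot (α := -β') (Weight.IsNonZero.neg hβ') hE hF
  rw [coroot_neg] at this
  apply Subtype.ext
  rw [← this]
  subst hco
  rfl

theorem IsRankOne.exists_eq_smul (hD : D.IsRankOne) (hγ : D.IsRestrictedGenerator γ γs)
    {h : 𝔱} (hh : h ∈ D.splitTorus) : ∃ c : ℂ, h = c • γs := by
  have h0 : (⟨γs, hγ.mem_split⟩ : D.splitTorus) ≠ 0 := by
    intro h
    have : γs = 0 := congrArg Subtype.val h
    simpa [this] using hγ.pairing
  obtain ⟨c, hc⟩ := (finrank_eq_one_iff_of_nonzero' _ h0).1 hD.rank_one ⟨h, hh⟩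
  exact ⟨c, (congrArg Subtype.val hc).symm⟩

/-- In rank one, a linear form which is anti-invariant under `σ` is a multiple of `γ`. -/
theorem IsRankOne.eq_smul_of_anti (hD : D.IsRankOne) (hγ : D.IsRestrictedGenerator γ γs)
    {f : Module.Dual ℂ 𝔱} (hf : D.σDual f = -f) : f = f γs • γ := by
  ext h
  have hm : h - D.σT h ∈ D.splitTorus := by
    simp [splitTorus, σT_σT]
  obtain ⟨c, hc⟩ := hD.exists_eq_smul hγ hm
  have hanti {g : Module.Dual ℂ 𝔱} (hg : D.σDual g = -g) : 2 * g h = c * g γs := by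
    have h1 : g (D.σT h) = -g h := congrArg (fun φ => φ h) hg
    have h2 := congrArg g hc
    rw [map_sub, h1, map_smul, smul_eq_mul] at h2
    linear_combination h2
  have h1 := hanti hf
  have h2 := hanti hγ.anti
  rw [hγ.pairing] at h2
  simp only [LinearMap.smul_apply, smul_eq_mul]
  linear_combination h1 / 2 - f γs * h2 / 2

/-- Roots in `Φₛ⁺` do not vanish on the split torus, hence are positive on the open chamber. -/
theorem IsRankOne.rootsS_pos (hD : D.IsRankOne) (hγ : D.IsRestrictedGenerator γ γs)
    {β : Weight ℂ 𝔱 𝔤} (hβ : β ∈ D.rootsS) : 0 < (β γs).re := by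
  refine lt_of_le_of_ne (hγ.chamber β hβ) fun h0 => ?_
  have hβr : β ∈ 𝔱.root := D.rootsB_closed.1 (mem_rootsBL.1 (mem_rootsS.1 hβ).1).1
  have hz : β γs = 0 := Complex.ext h0.symm (hγ.real β hβr)
  refine (mem_rootsS.1 hβ).2 ?_
  ext h
  have hm : h - D.σT h ∈ D.splitTorus := by
    simp [splitTorus, σT_σT]
  obtain ⟨c, hc⟩ := hD.exists_eq_smul hγ hm
  have h2 := congrArg (β : 𝔱 →ₗ[ℂ] ℂ) hc
  have hz' : (β : 𝔱 →ₗ[ℂ] ℂ) γs = 0 := hz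
  rw [map_sub, map_smul, hz', smul_zero, sub_eq_zero] at h2
  exact h2.symm

/-- `κ(β, γ) > 0` for all `β ∈ Φₛ⁺`: by rank one `γ` is a positive multiple of `β - σ(β)`, and
`σ`, being an automorphism of `𝔩`, preserves the Cartan integers of roots of `𝔩`, although it need
not preserve `κ`. -/
theorem IsRankOne.killingDual_pos (hD : D.IsRankOne) (hγ : D.IsRestrictedGenerator γ γs)
    {β : Weight ℂ 𝔱 𝔤} (hβ : β ∈ D.rootsS) : 0 < killingDual (β : 𝔱 →ₗ[ℂ] ℂ) γ := by
  have hb := hD.rootsS_pos hγ hβ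
  have hβL := (mem_rootsS.1 hβ).1
  have hβr : β ∈ 𝔱.root := D.rootsB_closed.1 (mem_rootsBL.1 hβL).1
  obtain ⟨β', hβ', h⟩ := (hD.borel_adapted β hβL).resolve_left (mem_rootsS.1 hβ).2
  have hβ0 := isNonZero_of_mem_rootsBL hβL
  have hβ'0 := isNonZero_of_mem_rootsBL hβ'
  have hval (x : 𝔱) : β' x = -β (D.σT x) := by
    have := congrArg (fun φ => φ x) h
    simpa [σDual] using this
  have hσγ : D.σT γs = -γs := by
    have := hγ.mem_split
    simp only [splitTorus, LinearMap.mem_ker, LinearMap.add_apply, LinearMap.id_apply] at this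
    exact eq_neg_of_add_eq_zero_left this
  have hβγ : β γs = (β γs).re := Complex.ext rfl (by simpa using hγ.real β hβr)
  have hsum : (β : 𝔱 →ₗ[ℂ] ℂ) + (β' : 𝔱 →ₗ[ℂ] ℂ) = ((2 * (β γs).re : ℝ) : ℂ) • γ := by
    have hanti : D.σDual ((β : 𝔱 →ₗ[ℂ] ℂ) + (β' : 𝔱 →ₗ[ℂ] ℂ)) =
        -((β : 𝔱 →ₗ[ℂ] ℂ) + (β' : 𝔱 →ₗ[ℂ] ℂ)) := by
      ext x
      simp [σDual, hval, σT_σT]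
    have := hD.eq_smul_of_anti hγ hanti
    rw [this]
    congr 1
    have hneg : β (-γs) = -β γs := (β : 𝔱 →ₗ[ℂ] ℂ).map_neg γs
    simp only [LinearMap.add_apply, Weight.toLinear_apply, hval, hσγ, hneg, neg_neg]
    push_cast
    rw [← hβγ]
    ring
  have hγ0 : γ ≠ 0 := by
    rintro rfl
    simpa using hγ.pairing
  have hpos := killingDual_add_pos hβ0 hβ'0 ?_ ?_
  · rw [hsum, killingDual_eq, map_smul, map_smul, smul_eq_mul, Complex.re_ofReal_mul] at hpos
    rw [killingDual_eq]
    exact pos_of_mul_pos_right hpos (by positivity)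
  · rw [hval, σT_coroot hβL h hβ'0]
    have : β (-coroot β') = -β (coroot β') := (β : 𝔱 →ₗ[ℂ] ℂ).map_neg _
    rw [this, neg_neg]
  · rw [hsum]
    exact smul_ne_zero (by exact_mod_cast (by positivity)) hγ0

theorem killingDual_sub_smul (f g : Module.Dual ℂ 𝔱) (p : ℝ) :
    killingDual f (g - (p : ℂ) • γ) = killingDual f g - p * killingDual f γ := by
  simp only [killingDual_eq, map_sub, map_smul, smul_eq_mul, Complex.sub_re, Complex.re_ofReal_mul]

theorem killingDual_smul (f : Module.Dual ℂ 𝔱) (p : ℝ) :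
    killingDual f ((p : ℂ) • γ) = p * killingDual f γ := by
  simp only [killingDual_eq, map_smul, smul_eq_mul, Complex.re_ofReal_mul]

theorem v₀_eq (p : ℝ) :
    D.v₀ γ p = p ^ D.r * ∏ β ∈ D.rootsS, killingDual (β : 𝔱 →ₗ[ℂ] ℂ) γ := by
  simp only [v₀, killingDual_smul, Finset.prod_mul_distrib, Finset.prod_const, r]

end Datum

end HorosymmetricDatum

/-! ### Primitives divided by powers -/

namespace StenzelLimit

open MeasureTheory

/-- The moment `∫₀¹ tʳ f(t x) dt`. It is the quotient of `∫₀ˣ tʳ f(t) dt` by `x ^ (r + 1)`,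
written in a form which is visibly as regular as `f` at the origin. -/
def radialMean (r : ℕ) (f : ℝ → ℝ) (x : ℝ) : ℝ := ∫ t in (0 : ℝ)..1, t ^ r * f (t * x)

theorem continuous_radialMean (r : ℕ) {f : ℝ → ℝ} (hf : Continuous f) :
    Continuous (radialMean r f) :=
  intervalIntegral.continuous_parametric_intervalIntegral_of_continuous'
    (f := fun x t => t ^ r * f (t * x)) (by fun_prop) 0 1

theorem hasDerivAt_radialMean (r : ℕ) {f : ℝ → ℝ} (hf : ContDiff ℝ 1 f) (x : ℝ) :
    HasDerivAt (radialMean r f) (radialMean (r + 1) (deriv f) x) x := by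
  have hf' : Continuous (deriv f) := hf.continuous_deriv le_rfl
  have hfc : Continuous f := hf.continuous
  obtain ⟨C, hC⟩ := (isCompact_Icc (a := -(|x| + 1)) (b := |x| + 1)).exists_bound_of_continuousOn
    hf'.continuousOn
  have key := intervalIntegral.hasDerivAt_integral_of_dominated_loc_of_deriv_le (𝕜 := ℝ)
    (μ := volume) (a := 0) (b := 1) (s := Metric.ball x 1)
    (F := fun y t => t ^ r * f (t * y)) (F' := fun y t => t ^ (r + 1) * deriv f (t * y))
    (x₀ := x) (bound := fun _ => C) (Metric.ball_mem_nhds x one_pos)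
    (Eventually.of_forall fun y =>
      (show Continuous fun t => t ^ r * f (t * y) by fun_prop).aestronglyMeasurable)
    ((show Continuous fun t => t ^ r * f (t * x) by fun_prop).intervalIntegrable _ _)
    ((show Continuous fun t => t ^ (r + 1) * deriv f (t * x) by fun_prop).aestronglyMeasurable)
    ?_ (by simp) ?_
  · exact key.2
  · refine Eventually.of_forall fun t ht y hy => ?_
    rw [uIoc_of_le zero_le_one] at ht
    have hy' : |y| ≤ |x| + 1 := by
      have := abs_sub_abs_le_abs_sub y x
      rw [Metric.mem_ball, Real.dist_eq] at hy
      linarith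
    have hty : |t * y| ≤ |x| + 1 := by
      rw [abs_mul, abs_of_pos ht.1]
      calc t * |y| ≤ 1 * |y| := by gcongr; exact ht.2
        _ ≤ |x| + 1 := by simpa using hy'
    have h1 := hC (t * y) (by simpa using abs_le.1 hty)
    rw [norm_mul, norm_pow, Real.norm_eq_abs, abs_of_pos ht.1]
    calc t ^ (r + 1) * ‖deriv f (t * y)‖ ≤ 1 * ‖deriv f (t * y)‖ := by
          gcongr
          exact pow_le_one₀ ht.1.le ht.2
      _ ≤ C := by simpa using h1
  · refine Eventually.of_forall fun t _ y _ => ?_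
    have h1 : HasDerivAt (fun y => t * y) t y := by simpa using (hasDerivAt_id y).const_mul t
    have h2 := ((hf.differentiable one_ne_zero (t * y)).hasDerivAt.comp y h1).const_mul (t ^ r)
    have e : t ^ (r + 1) * deriv f (t * y) = t ^ r * (deriv f (t * y) * t) := by ring
    rw [e]
    exact h2

theorem contDiff_radialMean (n : ℕ) : ∀ (r : ℕ) {f : ℝ → ℝ}, ContDiff ℝ n f →
    ContDiff ℝ n (radialMean r f) := by
  induction n with
  | zero =>
    intro r f hf
    have hf' : Continuous f := contDiff_zero.1 hf
    exact contDiff_zero.2 (continuous_radialMean r hf')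
  | succ n ih =>
    intro r f hf
    have h1 : ContDiff ℝ 1 f := hf.of_le (by exact_mod_cast Nat.le_add_left 1 n)
    have hd : deriv (radialMean r f) = radialMean (r + 1) (deriv f) :=
      funext fun x => (hasDerivAt_radialMean r h1 x).deriv
    push_cast at hf ⊢
    rw [contDiff_succ_iff_deriv] at hf ⊢
    refine ⟨fun x => (hasDerivAt_radialMean r h1 x).differentiableAt, by simp, ?_⟩
    rw [hd]
    exact ih _ hf.2.2

theorem pow_mul_radialMean (r : ℕ) (f : ℝ → ℝ) (x : ℝ) :
    x ^ (r + 1) * radialMean r f x = ∫ t in (0 : ℝ)..x, t ^ r * f t := by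
  have h := intervalIntegral.mul_integral_comp_mul_right (a := 0) (b := 1) (c := x)
    (f := fun t => t ^ r * f t)
  rw [zero_mul, one_mul] at h
  rw [← h, radialMean, pow_succ', mul_assoc, ← intervalIntegral.integral_const_mul]
  congr 2
  ext t
  ring

theorem radialMean_pos (r : ℕ) {f : ℝ → ℝ} (hf : Continuous f) (hpos : ∀ x, 0 < f x) (x : ℝ) :
    0 < radialMean r f x := by
  refine intervalIntegral.intervalIntegral_pos_of_pos_on
    ((show Continuous fun t => t ^ r * f (t * x) by fun_prop).intervalIntegrable _ _)
    (fun t ht => mul_pos (pow_pos ht.1 r) (hpos _)) zero_lt_one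

theorem radialMean_even (r : ℕ) {f : ℝ → ℝ} (hf : ∀ x, f (-x) = f x) (x : ℝ) :
    radialMean r f (-x) = radialMean r f x := by
  simp only [radialMean, mul_neg, hf]

/-- The odd function `Θ` with `Θ(x) ^ (r + 1) = ∫₀ˣ tʳ f(t) dt`, for `f` positive. Writing it as
`x` times a root of a positive function displays its regularity at the origin. -/
def radialRoot (r : ℕ) (f : ℝ → ℝ) (x : ℝ) : ℝ := x * radialMean r f x ^ ((r : ℝ) + 1)⁻¹

section radialRoot

variable {r : ℕ} {f : ℝ → ℝ}

theorem radialRoot_pow (hf : Continuous f) (hpos : ∀ x, 0 < f x) (x : ℝ) :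
    radialRoot r f x ^ (r + 1) = ∫ t in (0 : ℝ)..x, t ^ r * f t := by
  rw [radialRoot, mul_pow, ← pow_mul_radialMean]
  congr 1
  have := Real.rpow_inv_natCast_pow (radialMean_pos r hf hpos x).le (Nat.succ_ne_zero r)
  push_cast at this
  exact this

theorem radialRoot_neg (hf : ∀ x, f (-x) = f x) (x : ℝ) :
    radialRoot r f (-x) = -radialRoot r f x := by
  rw [radialRoot, radialMean_even r hf, radialRoot, neg_mul]

theorem radialRoot_zero : radialRoot r f 0 = 0 := zero_mul _

theorem radialRoot_nonneg (hf : Continuous f) (hpos : ∀ x, 0 < f x) {x : ℝ} (hx : 0 ≤ x) :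
    0 ≤ radialRoot r f x :=
  mul_nonneg hx (Real.rpow_nonneg (radialMean_pos r hf hpos x).le _)

theorem contDiff_radialRoot {n : ℕ} (hf : ContDiff ℝ n f) (hpos : ∀ x, 0 < f x) :
    ContDiff ℝ n (radialRoot r f) :=
  contDiff_id.mul ((contDiff_radialMean n r hf).rpow_const_of_ne fun x =>
    (radialMean_pos r hf.continuous hpos x).ne')

theorem hasDerivAt_radialRoot_pow (hf : Continuous f) (hpos : ∀ x, 0 < f x) (x : ℝ) :
    HasDerivAt (fun x => radialRoot r f x ^ (r + 1)) (x ^ r * f x) x := by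
  have hc : Continuous fun t => t ^ r * f t := by fun_prop
  have h := intervalIntegral.integral_hasDerivAt_right (hc.intervalIntegrable 0 x)
    (hc.stronglyMeasurableAtFilter _ _) hc.continuousAt
  have : (fun x => radialRoot r f x ^ (r + 1)) = fun x => ∫ t in (0 : ℝ)..x, t ^ r * f t :=
    funext (radialRoot_pow hf hpos)
  rwa [this]

theorem radialRoot_pow_mul_deriv (hf : ContDiff ℝ 1 f) (hpos : ∀ x, 0 < f x) (x : ℝ) :
    (r + 1) * radialRoot r f x ^ r * deriv (radialRoot r f) x = x ^ r * f x := by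
  have hd : DifferentiableAt ℝ (radialRoot r f) x :=
    (contDiff_radialRoot (n := 1) (by exact_mod_cast hf) hpos).differentiable (by simp) x
  have h1 := (hd.hasDerivAt.pow (r + 1)).unique
    (hasDerivAt_radialRoot_pow (r := r) hf.continuous hpos x)
  simpa using h1

theorem deriv_radialRoot_pos (hf : ContDiff ℝ 1 f) (hpos : ∀ x, 0 < f x) (x : ℝ) :
    0 < deriv (radialRoot r f) x := by
  have hm := radialMean_pos r hf.continuous hpos x
  rcases eq_or_ne x 0 with rfl | hx
  · have hg : DifferentiableAt ℝ (fun x => radialMean r f x ^ ((r : ℝ) + 1)⁻¹) 0 :=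
      ((contDiff_radialMean 1 r (by exact_mod_cast hf)).differentiable (by simp) 0).rpow_const
        (Or.inl hm.ne')
    have h := (hasDerivAt_id (0 : ℝ)).mul hg.hasDerivAt
    have h' : deriv (radialRoot r f) 0 = radialMean r f 0 ^ ((r : ℝ) + 1)⁻¹ := by
      have := h.deriv
      simp only [id, one_mul, zero_mul, add_zero] at this
      exact this
    rw [h']
    exact Real.rpow_pos_of_pos hm _
  · have h := radialRoot_pow_mul_deriv (r := r) hf hpos x
    rw [radialRoot, mul_pow] at h
    have h2 : (r + 1) * (radialMean r f x ^ ((r : ℝ) + 1)⁻¹) ^ r * deriv (radialRoot r f) x =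
        f x := by
      refine mul_left_cancel₀ (pow_ne_zero r hx) ?_
      linear_combination h
    have h3 : 0 < (r + 1) * (radialMean r f x ^ ((r : ℝ) + 1)⁻¹) ^ r :=
      mul_pos (by positivity) (pow_pos (Real.rpow_pos_of_pos hm _) _)
    exact pos_of_mul_pos_right (h2 ▸ hpos x) h3.le

end radialRoot

/-- A continuous solution `z` of `Θ(z(x)) = T(x)` inherits the regularity of `Θ` and `T` when `Θ'`
does not vanish. -/
theorem contDiff_of_comp_eq {n : ℕ} (hn : 1 ≤ n) {Θ T z : ℝ → ℝ} (hΘ : ContDiff ℝ n Θ)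
    (hΘ' : ∀ x, deriv Θ x ≠ 0) (hT : ContDiff ℝ n T) (hz : Continuous z)
    (h : ∀ x, Θ (z x) = T x) : ContDiff ℝ n z := by
  rw [contDiff_iff_contDiffAt]
  intro x
  have hn' : (n : WithTop ℕ∞) ≠ 0 := by
    exact_mod_cast (by omega : n ≠ 0)
  have hd : HasStrictDerivAt Θ (deriv Θ (z x)) (z x) :=
    hΘ.contDiffAt.hasStrictDerivAt' ((hΘ.differentiable hn' _).hasDerivAt) hn'
  have hfd := (hd.hasStrictFDerivAt_equiv (hΘ' _))
  have hcd := hΘ.contDiffAt.to_localInverse (a := z x) hfd.hasFDerivAt hn'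
  have hloc : ∀ᶠ y in 𝓝 x, hΘ.contDiffAt.localInverse hfd.hasFDerivAt hn' (T y) = z y := by
    have := hfd.eventually_left_inverse
    filter_upwards [hz.continuousAt.eventually this] with y hy
    rw [← h y]
    exact hy
  rw [h x] at hcd
  have h2 : ContDiffAt ℝ n (hΘ.contDiffAt.localInverse hfd.hasFDerivAt hn' ∘ T) x :=
    ContDiffAt.comp x hcd hT.contDiffAt
  exact h2.congr_of_eventuallyEq (hloc.mono fun y hy => hy.symm)

/-! ### The density `J` and Kähler-Einstein potentials -/

section sinhProd

variable {ι : Type*} (S : Finset ι) (c : ι → ℝ)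

/-- The density `J(x) = ∏ sinh(cᵢ x)`. -/
def sinhProd (x : ℝ) : ℝ := ∏ i ∈ S, Real.sinh (c i * x)

/-- The smooth even function `J(x) / x ^ Card S`, expressed through
`sinh y / y = ∫₀¹ cosh(ty) dt`. -/
def sinhProdCore (x : ℝ) : ℝ := ∏ i ∈ S, c i * radialMean 0 Real.cosh (c i * x)

theorem sinh_eq_mul_radialMean (y : ℝ) : Real.sinh y = y * radialMean 0 Real.cosh y := by
  have h := pow_mul_radialMean 0 Real.cosh y
  simp only [zero_add, pow_one, pow_zero, one_mul] at h
  rw [h, intervalIntegral.integral_eq_sub_of_hasDerivAt (fun x _ => Real.hasDerivAt_sinh x)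
    (Real.continuous_cosh.intervalIntegrable _ _), Real.sinh_zero, sub_zero]

theorem sinhProd_eq (x : ℝ) : sinhProd S c x = x ^ S.card * sinhProdCore S c x := by
  rw [sinhProd, sinhProdCore, ← Finset.prod_const, ← Finset.prod_mul_distrib]
  refine Finset.prod_congr rfl fun i _ => ?_
  rw [sinh_eq_mul_radialMean]
  ring

theorem contDiff_sinhProdCore (n : ℕ) : ContDiff ℝ n (sinhProdCore S c) := by
  refine contDiff_prod fun i _ => contDiff_const.mul ?_
  exact (contDiff_radialMean n 0 Real.contDiff_cosh).comp (contDiff_const.mul contDiff_id)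

theorem sinhProdCore_even (x : ℝ) : sinhProdCore S c (-x) = sinhProdCore S c x := by
  simp only [sinhProdCore, mul_neg, radialMean_even 0 Real.cosh_neg]

theorem continuous_sinhProd : Continuous (sinhProd S c) := by
  unfold sinhProd
  fun_prop

variable {S c}

theorem sinhProdCore_pos (hc : ∀ i ∈ S, 0 < c i) (x : ℝ) : 0 < sinhProdCore S c x :=
  Finset.prod_pos fun i hi =>
    mul_pos (hc i hi) (radialMean_pos 0 Real.continuous_cosh Real.cosh_pos _)

theorem sinhProd_zero (hS : S.Nonempty) : sinhProd S c 0 = 0 := by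
  rw [sinhProd_eq, zero_pow hS.card_ne_zero, zero_mul]

theorem sinhProd_pos (hc : ∀ i ∈ S, 0 < c i) {x : ℝ} (hx : 0 < x) : 0 < sinhProd S c x := by
  rw [sinhProd_eq]
  exact mul_pos (pow_pos hx _) (sinhProdCore_pos hc x)

theorem sinhProd_nonneg (hc : ∀ i ∈ S, 0 < c i) {x : ℝ} (hx : 0 ≤ x) : 0 ≤ sinhProd S c x := by
  rw [sinhProd_eq]
  exact mul_nonneg (pow_nonneg hx _) (sinhProdCore_pos hc x).le

variable (S c) in
/-- The logarithmic derivative of `J`. -/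
def sinhProdLogDeriv (x : ℝ) : ℝ := ∑ i ∈ S, c i * Real.cosh (c i * x) / Real.sinh (c i * x)

theorem hasDerivAt_sinhProd (hc : ∀ i ∈ S, 0 < c i) {x : ℝ} (hx : 0 < x) :
    HasDerivAt (sinhProd S c) (sinhProd S c x * sinhProdLogDeriv S c x) x := by
  classical
  have h1 (i : ι) : HasDerivAt (fun x => Real.sinh (c i * x)) (c i * Real.cosh (c i * x)) x := by
    have h : HasDerivAt (fun x => c i * x) (c i) x := by
      simpa using (hasDerivAt_id x).const_mul (c i)
    simpa [mul_comm] using h.sinh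
  have h2 := HasDerivAt.fun_finsetProd (u := S) fun i _ => h1 i
  have e : sinhProd S c x * sinhProdLogDeriv S c x =
      ∑ i ∈ S, (∏ j ∈ S.erase i, Real.sinh (c j * x)) • (c i * Real.cosh (c i * x)) := by
    rw [sinhProdLogDeriv, Finset.mul_sum]
    refine Finset.sum_congr rfl fun i hi => ?_
    have hs : 0 < Real.sinh (c i * x) := Real.sinh_pos_iff.2 (mul_pos (hc i hi) hx)
    rw [sinhProd, ← Finset.mul_prod_erase S _ hi, smul_eq_mul]
    field_simp
  rw [e]
  exact h2

theorem sinhProdLogDeriv_antitoneOn (hc : ∀ i ∈ S, 0 < c i) :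
    AntitoneOn (sinhProdLogDeriv S c) (Ioi 0) := by
  intro x hx y hy hxy
  refine Finset.sum_le_sum fun i hi => ?_
  have hci := hc i hi
  have hsx : 0 < Real.sinh (c i * x) := Real.sinh_pos_iff.2 (mul_pos hci hx)
  have hsy : 0 < Real.sinh (c i * y) := Real.sinh_pos_iff.2 (mul_pos hci hy)
  rw [div_le_div_iff₀ hsy hsx]
  have h : 0 ≤ Real.sinh (c i * y - c i * x) :=
    Real.sinh_nonneg_iff.2 (by rw [← mul_sub]; exact mul_nonneg hci.le (sub_nonneg.2 hxy))
  rw [Real.sinh_sub] at h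
  nlinarith

theorem sum_le_sinhProdLogDeriv (hc : ∀ i ∈ S, 0 < c i) {x : ℝ} (hx : 0 < x) :
    ∑ i ∈ S, c i ≤ sinhProdLogDeriv S c x := by
  refine Finset.sum_le_sum fun i hi => ?_
  have hci := hc i hi
  have hsx : 0 < Real.sinh (c i * x) := Real.sinh_pos_iff.2 (mul_pos hci hx)
  rw [le_div_iff₀ hsx]
  exact mul_le_mul_of_nonneg_left (Real.sinh_lt_cosh _).le hci.le

end sinhProd

/-- The analytic content of the notion of Kähler-Einstein potential: `V` is the Duistermaat-Heckman
density, and `L` is the end point of the moment image. -/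
structure IsPotential {ι : Type*} (S : Finset ι) (c : ι → ℝ) (V : ℝ → ℝ) (L : ℝ) (u : ℝ → ℝ) :
    Prop where
  smooth : ContDiff ℝ ∞ u
  even : ∀ x, u (-x) = u x
  convex : ∀ x, 0 < deriv (deriv u) x
  image : deriv u '' Ici 0 = Ico 0 L
  ode : ∀ x, 0 < x →
    deriv (deriv u) x * V (deriv u x) = Real.exp (-(2 * u x)) * sinhProd S c x

theorem deriv_neg_of_even {u : ℝ → ℝ} (hu : ∀ x, u (-x) = u x) (x : ℝ) :
    deriv u (-x) = -deriv u x := by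
  have h := deriv_comp_neg u x
  rw [show (fun x => u (-x)) = u from funext hu] at h
  linarith

namespace IsPotential

variable {ι : Type*} {S : Finset ι} {c : ι → ℝ} {V : ℝ → ℝ} {L : ℝ} {u : ℝ → ℝ}

theorem contDiff_deriv (h : IsPotential S c V L u) : ContDiff ℝ ∞ (deriv u) :=
  (contDiff_infty_iff_deriv.1 h.smooth).2

theorem hasDerivAt (h : IsPotential S c V L u) (x : ℝ) : HasDerivAt u (deriv u x) x :=
  (h.smooth.differentiable (by simp) x).hasDerivAt

theorem hasDerivAt_deriv (h : IsPotential S c V L u) (x : ℝ) :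
    HasDerivAt (deriv u) (deriv (deriv u) x) x :=
  (h.contDiff_deriv.differentiable (by simp) x).hasDerivAt

theorem continuous (h : IsPotential S c V L u) : Continuous u := h.smooth.continuous

theorem deriv_neg (h : IsPotential S c V L u) (x : ℝ) : deriv u (-x) = -deriv u x :=
  deriv_neg_of_even h.even x

theorem deriv_zero (h : IsPotential S c V L u) : deriv u 0 = 0 := by
  have := h.deriv_neg 0
  rw [neg_zero] at this
  linarith

theorem strictMono (h : IsPotential S c V L u) : StrictMono (deriv u) :=
  strictMono_of_deriv_pos h.convex

theorem deriv_mem (h : IsPotential S c V L u) {x : ℝ} (hx : 0 ≤ x) : deriv u x ∈ Ico 0 L :=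
  h.image ▸ mem_image_of_mem _ hx

theorem deriv_pos (h : IsPotential S c V L u) {x : ℝ} (hx : 0 < x) : 0 < deriv u x := by
  rw [← h.deriv_zero]
  exact h.strictMono hx

theorem pos (h : IsPotential S c V L u) : 0 < L :=
  (h.deriv_mem le_rfl).1.trans_lt (h.deriv_mem le_rfl).2

theorem abs_deriv_lt (h : IsPotential S c V L u) (x : ℝ) : |deriv u x| < L := by
  rcases le_total 0 x with hx | hx
  · rw [abs_of_nonneg (h.deriv_mem hx).1]
    exact (h.deriv_mem hx).2
  · have := h.deriv_mem (neg_nonneg.2 hx)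
    rw [h.deriv_neg] at this
    rw [abs_of_nonpos (by linarith [this.1])]
    exact this.2

theorem exists_deriv_eq (h : IsPotential S c V L u) {p : ℝ} (hp : p ∈ Ico 0 L) :
    ∃ x, 0 ≤ x ∧ deriv u x = p := by
  rw [← h.image] at hp
  exact hp

theorem V_pos (hc : ∀ i ∈ S, 0 < c i) (h : IsPotential S c V L u) {p : ℝ} (hp : p ∈ Ioo 0 L) :
    0 < V p := by
  obtain ⟨x, hx, rfl⟩ := h.exists_deriv_eq ⟨hp.1.le, hp.2⟩
  have hx0 : 0 < x := by
    refine lt_of_le_of_ne hx ?_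
    rintro rfl
    exact hp.1.ne' h.deriv_zero
  have h1 := h.ode x hx0
  have h2 : 0 < deriv (deriv u) x * V (deriv u x) := by
    rw [h1]
    exact mul_pos (Real.exp_pos _) (sinhProd_pos hc hx0)
  exact pos_of_mul_pos_right h2 (h.convex x).le

theorem abs_sub_le (h : IsPotential S c V L u) (x y : ℝ) : |u x - u y| ≤ L * |x - y| := by
  have := Convex.norm_image_sub_le_of_norm_deriv_le (f := u) (C := L) (s := univ) (x := y) (y := x)
    (fun z _ => (h.hasDerivAt z).differentiableAt) (fun z _ => (h.abs_deriv_lt z).le) convex_univ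
    (mem_univ _) (mem_univ _)
  simpa [Real.norm_eq_abs] using this

/-- The graph of the convex function `u` lies above its tangents. -/
theorem tangent_le (h : IsPotential S c V L u) (x y : ℝ) : deriv u x * (y - x) ≤ u y - u x := by
  rcases lt_trichotomy x y with hxy | rfl | hxy
  · obtain ⟨z, hz, hz'⟩ := exists_deriv_eq_slope u hxy h.continuous.continuousOn
      fun z _ => (h.hasDerivAt z).differentiableAt.differentiableWithinAt
    rw [eq_div_iff (sub_pos.2 hxy).ne'] at hz'
    rw [← hz']
    exact mul_le_mul_of_nonneg_right (h.strictMono.monotone hz.1.le) (sub_pos.2 hxy).le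
  · simp
  · obtain ⟨z, hz, hz'⟩ := exists_deriv_eq_slope u hxy h.continuous.continuousOn
      fun z _ => (h.hasDerivAt z).differentiableAt.differentiableWithinAt
    rw [eq_div_iff (sub_pos.2 hxy).ne'] at hz'
    nlinarith [h.strictMono.monotone hz.2.le]

theorem le_apply (h : IsPotential S c V L u) (x : ℝ) : u 0 ≤ u x := by
  have := h.tangent_le 0 x
  rw [h.deriv_zero, zero_mul] at this
  linarith

theorem apply_le (h : IsPotential S c V L u) {x : ℝ} : u x ≤ u 0 + deriv u x * x := by
  have := h.tangent_le x 0
  linarith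

theorem apply_le' (h : IsPotential S c V L u) {x : ℝ} (hx : 0 ≤ x) : u x ≤ u 0 + L * x := by
  have := h.apply_le (x := x)
  have := mul_le_mul_of_nonneg_right (h.deriv_mem hx).2.le hx
  linarith

/-- The first integral of the equation: `∫₀^{u'(x)} V = ∫₀ˣ e^{-2u} J`. -/
theorem integral_eq (hS : S.Nonempty) (hV : Continuous V) (hV0 : V 0 = 0)
    (h : IsPotential S c V L u) {x : ℝ} (hx : 0 ≤ x) :
    ∫ p in (0 : ℝ)..deriv u x, V p =
      ∫ t in (0 : ℝ)..x, Real.exp (-(2 * u t)) * sinhProd S c t := by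
  have hd (t : ℝ) (ht : t ∈ uIcc 0 x) : HasDerivAt (fun t => ∫ p in (0 : ℝ)..deriv u t, V p)
      (Real.exp (-(2 * u t)) * sinhProd S c t) t := by
    rw [uIcc_of_le hx] at ht
    have h1 : HasDerivAt (fun q => ∫ p in (0 : ℝ)..q, V p) (V (deriv u t)) (deriv u t) :=
      intervalIntegral.integral_hasDerivAt_right (hV.intervalIntegrable _ _)
        (hV.stronglyMeasurableAtFilter _ _) hV.continuousAt
    have h2 := h1.comp t (h.hasDerivAt_deriv t)
    rcases eq_or_lt_of_le ht.1 with rfl | ht0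
    · rw [h.deriv_zero, hV0, zero_mul] at h2
      rw [sinhProd_zero hS, mul_zero]
      exact h2
    · rw [← h.ode t ht0, mul_comm]
      exact h2
  have hcont : Continuous fun t => Real.exp (-(2 * u t)) * sinhProd S c t := by
    have := h.continuous
    have := continuous_sinhProd S c
    fun_prop
  rw [intervalIntegral.integral_eq_sub_of_hasDerivAt hd (hcont.intervalIntegrable _ _),
    h.deriv_zero, intervalIntegral.integral_same, sub_zero]

theorem strictMonoOn_integral (hc : ∀ i ∈ S, 0 < c i) (hV : Continuous V)
    (h : IsPotential S c V L u) : StrictMonoOn (fun q => ∫ p in (0 : ℝ)..q, V p) (Icc 0 L) := by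
  have hd (q : ℝ) : HasDerivAt (fun q => ∫ p in (0 : ℝ)..q, V p) (V q) q :=
    intervalIntegral.integral_hasDerivAt_right (hV.intervalIntegrable _ _)
      (hV.stronglyMeasurableAtFilter _ _) hV.continuousAt
  refine strictMonoOn_of_deriv_pos (convex_Icc 0 L)
    (fun q _ => (hd q).continuousAt.continuousWithinAt) fun q hq => ?_
  rw [interior_Icc] at hq
  rw [(hd q).deriv]
  exact h.V_pos hc hq

/-- The density has order of vanishing exactly `Card S` at the origin, as otherwise no
solution of the equation could be smooth with `u''(0) > 0`. -/
theorem core_pos (hc : ∀ i ∈ S, 0 < c i) {N : ℝ → ℝ} (hN : Continuous N)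
    (h : IsPotential S c (fun p => p ^ S.card * N p) L u) : 0 < N 0 := by
  have hslope : Tendsto (fun x => deriv u x / x) (𝓝[>] 0) (𝓝 (deriv (deriv u) 0)) := by
    have := (h.hasDerivAt_deriv 0).tendsto_slope.mono_left
      (nhdsWithin_mono 0 (fun x (hx : 0 < x) => hx.ne') : 𝓝[>] (0 : ℝ) ≤ 𝓝[≠] 0)
    refine this.congr fun x => ?_
    rw [slope_def_field, h.deriv_zero, sub_zero, sub_zero]
  have hd2 : Continuous (deriv (deriv u)) :=
    (contDiff_infty_iff_deriv.1 h.contDiff_deriv).2.continuous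
  have hd1 : Continuous (deriv u) := h.contDiff_deriv.continuous
  have hcore := (contDiff_sinhProdCore S c 0).continuous
  have hl : Tendsto (fun x => deriv (deriv u) x * ((deriv u x / x) ^ S.card * N (deriv u x)))
      (𝓝[>] 0) (𝓝 (deriv (deriv u) 0 * (deriv (deriv u) 0 ^ S.card * N 0))) := by
    have h1 := (hd2.tendsto 0).mono_left (nhdsWithin_le_nhds (s := Ioi 0))
    have h2 := ((hN.comp hd1).tendsto 0).mono_left (nhdsWithin_le_nhds (s := Ioi 0))
    rw [Function.comp_apply, h.deriv_zero] at h2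
    exact h1.mul ((hslope.pow _).mul h2)
  have hr : Tendsto (fun x => Real.exp (-(2 * u x)) * sinhProdCore S c x)
      (𝓝[>] 0) (𝓝 (Real.exp (-(2 * u 0)) * sinhProdCore S c 0)) := by
    have hu := h.continuous
    exact ((show Continuous fun x => Real.exp (-(2 * u x)) * sinhProdCore S c x by
      fun_prop).tendsto 0).mono_left nhdsWithin_le_nhds
  have heq : (fun x => deriv (deriv u) x * ((deriv u x / x) ^ S.card * N (deriv u x)))
      =ᶠ[𝓝[>] 0] fun x => Real.exp (-(2 * u x)) * sinhProdCore S c x := by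
    filter_upwards [self_mem_nhdsWithin] with x hx
    have hx0 : (0 : ℝ) < x := hx
    have h1 := h.ode x hx0
    rw [sinhProd_eq] at h1
    refine mul_left_cancel₀ (pow_pos hx0 S.card).ne' ?_
    rw [div_pow]
    have : x ^ S.card ≠ 0 := (pow_pos hx0 S.card).ne'
    field_simp
    linear_combination h1
  have hlim := tendsto_nhds_unique (hl.congr' heq) hr
  have hpos : 0 < Real.exp (-(2 * u 0)) * sinhProdCore S c 0 :=
    mul_pos (Real.exp_pos _) (sinhProdCore_pos hc 0)
  rw [← hlim, ← mul_assoc] at hpos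
  exact pos_of_mul_pos_right hpos (mul_pos (h.convex 0) (pow_pos (h.convex 0) _)).le

end IsPotential

/-! ### Compactness and decay at infinity -/

/-- A pointwise bounded sequence of uniformly Lipschitz functions has a pointwise convergent
subsequence. -/
theorem exists_subseq_tendsto_of_lipschitz {f : ℕ → ℝ → ℝ} {K B : ℝ}
    (hlip : ∀ n x y, |f n x - f n y| ≤ K * |x - y|) (hB : ∀ n, |f n 0| ≤ B) :
    ∃ φ : ℕ → ℕ, StrictMono φ ∧ ∃ g : ℝ → ℝ, ∀ x,
      Tendsto (fun n => f (φ n) x) atTop (𝓝 (g x)) := by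
  have hcpt : IsCompact (Set.pi univ fun q : ℚ => Icc (-(B + K * |(q : ℝ)|)) (B + K * |(q : ℝ)|)) :=
    isCompact_univ_pi fun _ => isCompact_Icc
  have hmem (n : ℕ) : (fun q : ℚ => f n q) ∈
      Set.pi univ fun q : ℚ => Icc (-(B + K * |(q : ℝ)|)) (B + K * |(q : ℝ)|) := by
    intro q _
    have h1 := hlip n q 0
    rw [sub_zero] at h1
    have h2 := abs_sub_abs_le_abs_sub (f n q) (f n 0)
    exact abs_le.1 (by linarith [hB n])
  -- A diagonal subsequence converges at all rationals; the Lipschitz bound then gives convergence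
  -- at every real.
  obtain ⟨g, -, φ, hφ, hg⟩ := hcpt.tendsto_subseq hmem
  rw [tendsto_pi_nhds] at hg
  refine ⟨φ, hφ, ?_⟩
  have hK : 0 ≤ K := by
    have := (abs_nonneg _).trans (hlip 0 1 0)
    simpa using this
  have hconv (x : ℝ) : ∃ y, Tendsto (fun n => f (φ n) x) atTop (𝓝 y) := by
    refine cauchySeq_tendsto_of_complete ?_
    rw [Metric.cauchySeq_iff]
    intro ε hε
    obtain ⟨q, hq⟩ := Metric.denseRange_iff.1 Rat.denseRange_cast x (ε / (4 * (K + 1)))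
      (by positivity)
    rw [Real.dist_eq] at hq
    have hqK : K * |x - q| ≤ ε / 4 := by
      calc K * |x - q| ≤ (K + 1) * (ε / (4 * (K + 1))) := by gcongr; linarith
        _ = ε / 4 := by field_simp
    obtain ⟨n₀, hn₀⟩ := Metric.cauchySeq_iff.1 (hg q).cauchySeq (ε / 2) (by positivity)
    refine ⟨n₀, fun m hm n hn => ?_⟩
    have h1 := hn₀ m hm n hn
    simp only [Function.comp_apply, Real.dist_eq] at h1 ⊢
    have h2 := abs_le.1 (hlip (φ m) x q)
    have h3 := abs_le.1 (hlip (φ n) x q)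
    rw [abs_lt] at h1 ⊢
    constructor <;> linarith [h1.1, h1.2, h2.1, h2.2, h3.1, h3.2]
  choose g' hg' using hconv
  exact ⟨g', hg'⟩

/-- If `p` is a continuous selection of subgradients of `w`, then `w` is differentiable with
derivative `p`. -/
theorem hasDerivAt_of_subgradient {w p : ℝ → ℝ} (hp : Continuous p)
    (h : ∀ x y, p x * (y - x) ≤ w y - w x) (x : ℝ) : HasDerivAt w (p x) x := by
  rw [hasDerivAt_iff_isLittleO, Asymptotics.isLittleO_iff]
  intro ε hε
  filter_upwards [Metric.tendsto_nhds.1 (hp.tendsto x) ε hε] with y hy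
  rw [Real.dist_eq] at hy
  have h1 := h x y
  have h2 := h y x
  rw [Real.norm_eq_abs, Real.norm_eq_abs, smul_eq_mul]
  have h3 : (p y - p x) * (y - x) ≤ ε * |y - x| := by
    calc (p y - p x) * (y - x) ≤ |(p y - p x) * (y - x)| := le_abs_self _
      _ = |p y - p x| * |y - x| := abs_mul _ _
      _ ≤ ε * |y - x| := by gcongr
  rw [abs_le]
  constructor
  · have : 0 ≤ ε * |y - x| := by positivity
    linarith
  · linarith

variable {ι : Type*} {S : Finset ι} {c : ι → ℝ} {V : ℝ → ℝ}

variable (S c) in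
/-- The right hand side `e^{-2u} J` of the equation. -/
def massDensity (u : ℝ → ℝ) (x : ℝ) : ℝ := Real.exp (-(2 * u x)) * sinhProd S c x

theorem continuous_massDensity {u : ℝ → ℝ} (hu : Continuous u) :
    Continuous (massDensity S c u) := by
  have := continuous_sinhProd S c
  unfold massDensity
  fun_prop

theorem hasDerivAt_integral_massDensity {u : ℝ → ℝ} (hu : Continuous u) (x : ℝ) :
    HasDerivAt (fun x => ∫ t in (0 : ℝ)..x, massDensity S c u t) (massDensity S c u x) x :=
  intervalIntegral.integral_hasDerivAt_right ((continuous_massDensity hu).intervalIntegrable _ _)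
    ((continuous_massDensity hu).stronglyMeasurableAtFilter _ _)
    (continuous_massDensity hu).continuousAt

theorem massDensity_nonneg (hc : ∀ i ∈ S, 0 < c i) (u : ℝ → ℝ) {x : ℝ} (hx : 0 ≤ x) :
    0 ≤ massDensity S c u x :=
  mul_nonneg (Real.exp_pos _).le (sinhProd_nonneg hc hx)

/-- The mass at infinity is uniformly small: the density `e^{-2u} J` is log-concave, bounded below
at `1` and of bounded mass, hence it decays exponentially at a uniform rate. -/
theorem exists_tail_le (hc : ∀ i ∈ S, 0 < c i) {a b l M η : ℝ} (hM : 0 ≤ M) (hη : 0 < η) :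
    ∃ R, 0 < R ∧ ∀ (L : ℝ) (u : ℝ → ℝ), IsPotential S c V L u → L ≤ l → a ≤ u 0 → u 0 ≤ b →
      (∀ x, 0 ≤ x → ∫ t in (0 : ℝ)..x, massDensity S c u t ≤ M) → ∀ X, R ≤ X →
        (∫ t in (0 : ℝ)..X, massDensity S c u t) ≤
          (∫ t in (0 : ℝ)..R, massDensity S c u t) + η := by
  set c₀ := Real.exp (-(2 * (b + l))) * sinhProd S c 1 with hc₀
  have hc₀pos : 0 < c₀ := mul_pos (Real.exp_pos _) (sinhProd_pos hc one_pos)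
  set k := c₀ * Real.exp (-1) / (M + 1) with hk
  have hkpos : 0 < k := by positivity
  set R₁ := 1 + 1 / k with hR₁
  have hR₁1 : 1 < R₁ := by
    have : 0 < 1 / k := by positivity
    linarith
  set C := Real.exp (-(2 * a)) * sinhProd S c R₁ with hC
  have hCpos : 0 < C := mul_pos (Real.exp_pos _) (sinhProd_pos hc (by linarith))
  refine ⟨R₁ + C / (k * η) / k, by positivity, fun L u h hL ha hb hmass X hX => ?_⟩
  set ρ := massDensity S c u with hρ
  -- `κ` is the logarithmic derivative of `ρ`.
  set κ : ℝ → ℝ := fun x => -2 * deriv u x + sinhProdLogDeriv S c x with hκ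
  have hρd (x : ℝ) (hx : 0 < x) : HasDerivAt ρ (ρ x * κ x) x := by
    have h1 : HasDerivAt (fun x => Real.exp (-(2 * u x)))
        (Real.exp (-(2 * u x)) * (-(2 * deriv u x))) x := ((h.hasDerivAt x).const_mul 2).neg.exp
    refine (h1.fun_mul (hasDerivAt_sinhProd hc hx)).congr_deriv ?_
    simp only [hρ, hκ, massDensity]
    ring
  have hκanti : AntitoneOn κ (Ioi 0) := by
    intro x hx y hy hxy
    have h1 := sinhProdLogDeriv_antitoneOn hc hx hy hxy
    have h2 := h.strictMono.monotone hxy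
    simp only [hκ]
    linarith
  have hρpos (x : ℝ) (hx : 0 < x) : 0 < ρ x := mul_pos (Real.exp_pos _) (sinhProd_pos hc hx)
  -- `ρ x * exp (k * (x - x₀))` increases where `κ ≥ -k`, and decreases where `κ ≤ -k`.
  have hweight (x₀ x : ℝ) (hx : 0 < x) : HasDerivAt (fun x => ρ x * Real.exp (k * (x - x₀)))
      (ρ x * Real.exp (k * (x - x₀)) * (κ x + k)) x := by
    have h1 : HasDerivAt (fun x => k * (x - x₀)) k x := by
      simpa using ((hasDerivAt_id x).sub_const x₀).const_mul k
    exact ((hρd x hx).fun_mul h1.exp).congr_deriv (by ring)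
  have hQ := hasDerivAt_integral_massDensity (S := S) (c := c) h.continuous
  -- Otherwise `ρ ≥ c₀ / e` on the interval `[1, R₁]` of length `1 / k`, whose mass then exceeds `M`
  -- by the choice of `k`.
  have hκR : κ R₁ ≤ -k := by
    by_contra hlt
    push Not at hlt
    have hlow (t : ℝ) (ht : t ∈ Icc 1 R₁) : c₀ * Real.exp (-1) ≤ ρ t := by
      have hmono : MonotoneOn (fun x => ρ x * Real.exp (k * (x - 1))) (Icc 1 R₁) := by
        refine monotoneOn_of_deriv_nonneg (convex_Icc _ _)
          (fun x hx => (hweight 1 x (by linarith [hx.1])).continuousAt.continuousWithinAt)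
          (fun x hx => ?_) fun x hx => ?_
        · rw [interior_Icc] at hx
          exact (hweight 1 x (by linarith [hx.1])).differentiableAt.differentiableWithinAt
        · rw [interior_Icc] at hx
          have hx0 : 0 < x := by linarith [hx.1]
          rw [(hweight 1 x hx0).deriv]
          have := hκanti hx0 (show (0 : ℝ) < R₁ by linarith) hx.2.le
          exact mul_nonneg (mul_pos (hρpos x hx0) (Real.exp_pos _)).le (by linarith)
      have h1 := hmono ⟨le_rfl, hR₁1.le⟩ ht ht.1
      simp only [sub_self, mul_zero, Real.exp_zero, mul_one] at h1
      have h2 : c₀ ≤ ρ 1 := by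
        refine mul_le_mul_of_nonneg_right (Real.exp_le_exp.2 ?_) (sinhProd_pos hc one_pos).le
        have := h.apply_le' zero_le_one
        linarith
      have h3 : Real.exp (k * (t - 1)) ≤ Real.exp 1 := by
        refine Real.exp_le_exp.2 ?_
        have : t - 1 ≤ 1 / k := by linarith [ht.2]
        calc k * (t - 1) ≤ k * (1 / k) := by gcongr
          _ = 1 := by field_simp
      have h4 : c₀ ≤ ρ t * Real.exp 1 := by
        refine (h2.trans h1).trans ?_
        exact mul_le_mul_of_nonneg_left h3 (hρpos t (by linarith [ht.1])).le
      calc c₀ * Real.exp (-1) ≤ ρ t * Real.exp 1 * Real.exp (-1) := by gcongr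
        _ = ρ t := by rw [mul_assoc, ← Real.exp_add]; simp
    have hmono : MonotoneOn (fun x => (∫ t in (0 : ℝ)..x, ρ t) - c₀ * Real.exp (-1) * x)
        (Icc 1 R₁) := by
      have hd (x : ℝ) : HasDerivAt (fun x => (∫ t in (0 : ℝ)..x, ρ t) - c₀ * Real.exp (-1) * x)
          (ρ x - c₀ * Real.exp (-1)) x := by
        exact ((hQ x).fun_sub ((hasDerivAt_id x).const_mul (c₀ * Real.exp (-1)))).congr_deriv
          (by ring)
      refine monotoneOn_of_deriv_nonneg (convex_Icc _ _)
        (fun x _ => (hd x).continuousAt.continuousWithinAt)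
        (fun x _ => (hd x).differentiableAt.differentiableWithinAt) fun x hx => ?_
      rw [(hd x).deriv]
      exact sub_nonneg.2 (hlow x (interior_subset hx))
    have h1 := hmono ⟨le_rfl, hR₁1.le⟩ ⟨hR₁1.le, le_rfl⟩ hR₁1.le
    simp only at h1
    have h2 := hmass R₁ (by linarith)
    have h3 : 0 ≤ ∫ t in (0 : ℝ)..1, ρ t :=
      intervalIntegral.integral_nonneg zero_le_one fun t ht => massDensity_nonneg hc u ht.1
    have h4 : c₀ * Real.exp (-1) * R₁ = c₀ * Real.exp (-1) + (M + 1) := by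
      rw [hR₁, hk]
      field_simp
    linarith
  have hup (t : ℝ) (ht : R₁ ≤ t) : ρ t ≤ C * Real.exp (-(k * (t - R₁))) := by
    have hanti : AntitoneOn (fun x => ρ x * Real.exp (k * (x - R₁))) (Ici R₁) := by
      refine antitoneOn_of_deriv_nonpos (convex_Ici _)
        (fun x hx => (hweight R₁ x (by linarith [mem_Ici.1 hx])).continuousAt.continuousWithinAt)
        (fun x hx => ?_) fun x hx => ?_
      · rw [interior_Ici] at hx
        exact (hweight R₁ x (by linarith [mem_Ioi.1 hx])).differentiableAt.differentiableWithinAt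
      · rw [interior_Ici] at hx
        have hx0 : 0 < x := by linarith [mem_Ioi.1 hx]
        rw [(hweight R₁ x hx0).deriv]
        have := hκanti (show (0 : ℝ) < R₁ by linarith) hx0 (mem_Ioi.1 hx).le
        exact mul_nonpos_of_nonneg_of_nonpos (mul_pos (hρpos x hx0) (Real.exp_pos _)).le
          (by linarith)
    have h1 := hanti (mem_Ici.2 le_rfl) (mem_Ici.2 ht) ht
    simp only [sub_self, mul_zero, Real.exp_zero, mul_one] at h1
    have h2 : ρ R₁ ≤ C := by
      refine mul_le_mul_of_nonneg_right (Real.exp_le_exp.2 ?_) (sinhProd_pos hc (by linarith)).le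
      linarith [h.le_apply R₁]
    calc ρ t = ρ t * Real.exp (k * (t - R₁)) * Real.exp (-(k * (t - R₁))) := by
          rw [mul_assoc, ← Real.exp_add]; simp
      _ ≤ C * Real.exp (-(k * (t - R₁))) := by gcongr; exact h1.trans h2
  have hanti : AntitoneOn
      (fun x => (∫ t in (0 : ℝ)..x, ρ t) + C / k * Real.exp (-(k * (x - R₁)))) (Ici R₁) := by
    have hd (x : ℝ) : HasDerivAt
        (fun x => (∫ t in (0 : ℝ)..x, ρ t) + C / k * Real.exp (-(k * (x - R₁))))
        (ρ x - C * Real.exp (-(k * (x - R₁)))) x := by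
      have h1 : HasDerivAt (fun x => -(k * (x - R₁))) (-k) x := by
        exact (((hasDerivAt_id x).sub_const R₁).const_mul k).fun_neg.congr_deriv (by ring)
      refine ((hQ x).fun_add (h1.exp.const_mul (C / k))).congr_deriv ?_
      field_simp
      ring
    refine antitoneOn_of_deriv_nonpos (convex_Ici _)
      (fun x _ => (hd x).continuousAt.continuousWithinAt)
      (fun x _ => (hd x).differentiableAt.differentiableWithinAt) fun x hx => ?_
    rw [(hd x).deriv]
    exact sub_nonpos.2 (hup x (interior_subset hx))
  set R := R₁ + C / (k * η) / k with hR
  have hRR₁ : R₁ ≤ R := by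
    have : 0 < C / (k * η) / k := by positivity
    linarith
  have h1 := hanti (mem_Ici.2 hRR₁) (mem_Ici.2 (hRR₁.trans hX)) hX
  simp only at h1
  have h2 : C / k * Real.exp (-(k * (R - R₁))) ≤ η := by
    have e : k * (R - R₁) = C / (k * η) := by
      rw [hR]
      field_simp
      ring
    rw [e, Real.exp_neg, ← div_eq_mul_inv, div_le_iff₀ (Real.exp_pos _)]
    have := Real.add_one_le_exp (C / (k * η))
    calc C / k = η * (C / (k * η)) := by field_simp
      _ ≤ η * Real.exp (C / (k * η)) := by gcongr; linarith
  have h3 : 0 ≤ C / k * Real.exp (-(k * (X - R₁))) := by positivity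
  linarith

/-! ### Solutions at the limit of the parameter -/

/-- The positive smooth factor of `e^{-2u} J`. -/
def massCore (S : Finset ι) (c : ι → ℝ) (u : ℝ → ℝ) (x : ℝ) : ℝ :=
  Real.exp (-(2 * u x)) * sinhProdCore S c x

theorem massCore_pos (hc : ∀ i ∈ S, 0 < c i) (u : ℝ → ℝ) (x : ℝ) : 0 < massCore S c u x :=
  mul_pos (Real.exp_pos _) (sinhProdCore_pos hc x)

theorem massCore_even {u : ℝ → ℝ} (hu : ∀ x, u (-x) = u x) (x : ℝ) :
    massCore S c u (-x) = massCore S c u x := by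
  rw [massCore, massCore, hu, sinhProdCore_even]

theorem contDiff_massCore {n : ℕ} {u : ℝ → ℝ} (hu : ContDiff ℝ n u) :
    ContDiff ℝ n (massCore S c u) :=
  ((contDiff_const.mul hu).neg.exp).mul (contDiff_sinhProdCore S c n)

theorem massDensity_eq (u : ℝ → ℝ) (x : ℝ) :
    massDensity S c u x = x ^ S.card * massCore S c u x := by
  rw [massDensity, massCore, sinhProd_eq]
  ring

theorem radialRoot_massCore_pow (hc : ∀ i ∈ S, 0 < c i) {u : ℝ → ℝ} (hu : Continuous u) (x : ℝ) :
    radialRoot S.card (massCore S c u) x ^ (S.card + 1) =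
      ∫ t in (0 : ℝ)..x, massDensity S c u t := by
  rw [radialRoot_pow (contDiff_massCore (n := 0) (contDiff_zero.2 hu)).continuous
    (massCore_pos hc u)]
  simp only [massDensity_eq]

/-- Regularity at the limit. The change of variable `w' = u₀'(z)`, with `u₀` a given solution,
turns the equation into `Θ₀(z) = Θ(x)`, where the functions `Θ₀`, `Θ` are odd, as regular as `u₀`
and `w`, and of positive derivative; in this form nothing degenerates at the origin, and the
regularity of `w` can be bootstrapped. -/
theorem smooth_of_subgradient (hc : ∀ i ∈ S, 0 < c i) (hS : S.Nonempty) (hV : Continuous V)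
    (hV0 : V 0 = 0) {l ℓ : ℝ} (hl : ℓ < l) {u₀ : ℝ → ℝ} (h₀ : IsPotential S c V l u₀) {w : ℝ → ℝ}
    (hw : Continuous w) (heven : ∀ x, w (-x) = w x)
    (hp : ∀ x, 0 ≤ x → ∃ p ∈ Icc 0 ℓ, (∫ q in (0 : ℝ)..p, V q) =
      (∫ t in (0 : ℝ)..x, massDensity S c w t) ∧ ∀ y, p * (y - x) ≤ w y - w x) :
    ContDiff ℝ ∞ w ∧ (∀ x, 0 < deriv (deriv w) x) ∧ ∀ x, 0 ≤ x → deriv w x ∈ Icc 0 ℓ ∧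
      (∫ q in (0 : ℝ)..deriv w x, V q) = ∫ t in (0 : ℝ)..x, massDensity S c w t := by
  set Θ₀ := radialRoot S.card (massCore S c u₀) with hΘ₀
  set Θ := radialRoot S.card (massCore S c w) with hΘ
  have hu₀n (n : ℕ) : ContDiff ℝ n u₀ := contDiff_infty.1 h₀.smooth n
  have hΘ₀n (n : ℕ) : ContDiff ℝ n Θ₀ :=
    contDiff_radialRoot (contDiff_massCore (hu₀n n)) (massCore_pos hc u₀)
  have hΘn {n : ℕ} (hwn : ContDiff ℝ n w) : ContDiff ℝ n Θ :=
    contDiff_radialRoot (contDiff_massCore hwn) (massCore_pos hc w)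
  have hΘ₀c : Continuous Θ₀ := (hΘ₀n 0).continuous
  have hΘc : Continuous Θ := (hΘn (n := 0) (contDiff_zero.2 hw)).continuous
  have hΘ₀' (x : ℝ) : 0 < deriv Θ₀ x :=
    deriv_radialRoot_pos (by exact_mod_cast contDiff_massCore (S := S) (c := c) (hu₀n 1))
      (massCore_pos hc u₀) x
  have hmono : StrictMono Θ₀ := strictMono_of_deriv_pos hΘ₀'
  have hz_nonneg (x : ℝ) (hx : 0 ≤ x) : ∃ z, Θ₀ z = Θ x ∧
      (∀ y, deriv u₀ z * (y - x) ≤ w y - w x) ∧ deriv u₀ z ∈ Icc 0 ℓ ∧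
        (∫ q in (0 : ℝ)..deriv u₀ z, V q) = ∫ t in (0 : ℝ)..x, massDensity S c w t := by
    obtain ⟨p, hpmem, hpF, hpy⟩ := hp x hx
    obtain ⟨z, hz, rfl⟩ := h₀.exists_deriv_eq ⟨hpmem.1, hpmem.2.trans_lt hl⟩
    refine ⟨z, ?_, hpy, hpmem, hpF⟩
    have h1 := h₀.integral_eq hS hV hV0 hz
    rw [hpF] at h1
    have h2 : Θ₀ z ^ (S.card + 1) = Θ x ^ (S.card + 1) := by
      rw [hΘ₀, hΘ, radialRoot_massCore_pow hc h₀.continuous, radialRoot_massCore_pow hc hw]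
      exact h1.symm
    exact (pow_left_inj₀ (radialRoot_nonneg (contDiff_massCore (hu₀n 0)).continuous
      (massCore_pos hc u₀) hz) (radialRoot_nonneg
        (contDiff_massCore (n := 0) (contDiff_zero.2 hw)).continuous (massCore_pos hc w) hx)
          (Nat.succ_ne_zero _)).1 h2
  have hz_all (x : ℝ) : ∃ z, Θ₀ z = Θ x ∧ (∀ y, deriv u₀ z * (y - x) ≤ w y - w x) ∧
      (0 ≤ x → deriv u₀ z ∈ Icc 0 ℓ ∧
        (∫ q in (0 : ℝ)..deriv u₀ z, V q) = ∫ t in (0 : ℝ)..x, massDensity S c w t) := by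
    rcases le_or_gt 0 x with hx | hx
    · obtain ⟨z, h1, h2, h3⟩ := hz_nonneg x hx
      exact ⟨z, h1, h2, fun _ => h3⟩
    · obtain ⟨z, h1, h2, -⟩ := hz_nonneg (-x) (by linarith)
      refine ⟨-z, ?_, fun y => ?_, fun h => absurd h (not_le.2 hx)⟩
      · have e1 := radialRoot_neg (r := S.card) (massCore_even (S := S) (c := c) h₀.even) z
        have e2 := radialRoot_neg (r := S.card) (massCore_even (S := S) (c := c) heven) x
        rw [← hΘ₀] at e1
        rw [← hΘ] at e2
        rw [e1, h1, e2, neg_neg]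
      · have := h2 (-y)
        rw [heven, heven] at this
        rw [h₀.deriv_neg]
        linarith
  choose z hzΘ hzw hzF using hz_all
  have hzc : Continuous z := by
    -- A strictly monotone continuous function has a continuous inverse on its range.
    have hemb : IsEmbedding Θ₀ :=
      hmono.isEmbedding_of_ordConnected (isPreconnected_range hΘ₀c).ordConnected
    rw [hemb.continuous_iff]
    have : Θ₀ ∘ z = Θ := funext hzΘ
    rw [this]
    exact hΘc
  have hpc : Continuous fun x => deriv u₀ (z x) := h₀.contDiff_deriv.continuous.comp hzc
  have hwd (x : ℝ) : HasDerivAt w (deriv u₀ (z x)) x := hasDerivAt_of_subgradient hpc hzw x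
  have hwd' : deriv w = fun x => deriv u₀ (z x) := funext fun x => (hwd x).deriv
  have hzn {n : ℕ} (hwn : ContDiff ℝ (n + 1 : ℕ) w) : ContDiff ℝ (n + 1 : ℕ) z :=
    contDiff_of_comp_eq (Nat.le_add_left 1 n) (hΘ₀n _) (fun x => (hΘ₀' x).ne') (hΘn hwn) hzc hzΘ
  have hwn (n : ℕ) : ContDiff ℝ (n + 1 : ℕ) w := by
    induction n with
    | zero =>
      rw [zero_add, Nat.cast_one, contDiff_one_iff_deriv, hwd']
      exact ⟨fun x => (hwd x).differentiableAt, hpc⟩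
    | succ n ih =>
      rw [Nat.cast_add, Nat.cast_one, contDiff_succ_iff_deriv]
      refine ⟨fun x => (hwd x).differentiableAt, by simp, ?_⟩
      rw [hwd']
      exact (contDiff_infty.1 h₀.contDiff_deriv (n + 1)).comp (hzn ih)
  refine ⟨contDiff_infty.2 fun n => (hwn n).of_le (by exact_mod_cast Nat.le_succ n), fun x => ?_,
    fun x hx => by rw [hwd']; exact hzF x hx⟩
  have hzd : HasDerivAt z (deriv z x) x :=
    ((hzn (hwn 0)).differentiable (by simp) x).hasDerivAt
  have hz' : 0 < deriv z x := by
    have h1 : HasDerivAt (fun x => Θ₀ (z x)) (deriv Θ₀ (z x) * deriv z x) x :=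
      (((hΘ₀n 1).differentiable (by simp) (z x)).hasDerivAt).comp x hzd
    rw [show (fun x => Θ₀ (z x)) = Θ from funext hzΘ] at h1
    have h2 : 0 < deriv Θ x :=
      deriv_radialRoot_pos (by
        exact_mod_cast contDiff_massCore (S := S) (c := c) (n := 1) (by simpa using hwn 0))
        (massCore_pos hc w) x
    rw [h1.deriv] at h2
    exact pos_of_mul_pos_right h2 (hΘ₀' _).le
  rw [hwd']
  have := ((h₀.hasDerivAt_deriv (z x)).comp x hzd).deriv
  rw [show (fun x => deriv u₀ (z x)) = deriv u₀ ∘ z from rfl, this]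
  exact mul_pos (h₀.convex _) hz'

/-- Closedness of the set of solvable end points: a sequence of solutions whose end points converge,
and whose values at the origin are bounded above, produces a solution at the limit. -/
theorem exists_isPotential_of_tendsto (hc : ∀ i ∈ S, 0 < c i) (hS : S.Nonempty) (hV : Continuous V)
    (hV0 : V 0 = 0) {l ℓ K : ℝ} (hl : ℓ < l) {u₀ : ℝ → ℝ} (h₀ : IsPotential S c V l u₀)
    {u : ℕ → ℝ → ℝ} {L : ℕ → ℝ} (hu : ∀ n, IsPotential S c V (L n) (u n)) (hLl : ∀ n, L n ≤ l)
    (hL : Tendsto L atTop (𝓝 ℓ)) (hK : ∀ n, u n 0 ≤ K) : ∃ w, IsPotential S c V ℓ w := by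
  set F : ℝ → ℝ := fun q => ∫ p in (0 : ℝ)..q, V p with hF
  have hFmono : StrictMonoOn F (Icc 0 l) := h₀.strictMonoOn_integral hc hV
  have hFc : Continuous F := by
    have (q : ℝ) : HasDerivAt F (V q) q :=
      intervalIntegral.integral_hasDerivAt_right (hV.intervalIntegrable _ _)
        (hV.stronglyMeasurableAtFilter _ _) hV.continuousAt
    exact continuous_iff_continuousAt.2 fun q => (this q).continuousAt
  have hF0 : F 0 = 0 := intervalIntegral.integral_same
  have hl0 : 0 < l := h₀.pos
  have hmem (n : ℕ) {x : ℝ} (hx : 0 ≤ x) : deriv (u n) x ∈ Icc 0 l :=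
    ⟨((hu n).deriv_mem hx).1, ((hu n).deriv_mem hx).2.le.trans (hLl n)⟩
  have hFu (n : ℕ) {x : ℝ} (hx : 0 ≤ x) :
      F (deriv (u n) x) = ∫ t in (0 : ℝ)..x, massDensity S c (u n) t :=
    (hu n).integral_eq hS hV hV0 hx
  have hmass (n : ℕ) (x : ℝ) (hx : 0 ≤ x) :
      ∫ t in (0 : ℝ)..x, massDensity S c (u n) t ≤ F l := by
    rw [← hFu n hx]
    exact hFmono.monotoneOn (hmem n hx) ⟨hl0.le, le_rfl⟩ (hmem n hx).2
  have hJc := continuous_sinhProd S c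
  have hG : 0 < ∫ t in (0 : ℝ)..1, sinhProd S c t :=
    intervalIntegral.intervalIntegral_pos_of_pos_on (hJc.intervalIntegrable _ _)
      (fun t ht => sinhProd_pos hc ht.1) one_pos
  -- The values at the origin are bounded below, since the total mass is bounded.
  obtain ⟨a, ha⟩ : ∃ a, ∀ n, a ≤ u n 0 := by
    refine ⟨-(Real.log (F l / ∫ t in (0 : ℝ)..1, sinhProd S c t) / 2) - l, fun n => ?_⟩
    have h1 : Real.exp (-(2 * (u n 0 + l))) * (∫ t in (0 : ℝ)..1, sinhProd S c t) ≤ F l := by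
      refine le_trans ?_ (hmass n 1 zero_le_one)
      rw [← intervalIntegral.integral_const_mul]
      refine intervalIntegral.integral_mono_on zero_le_one
        ((hJc.intervalIntegrable _ _).const_mul _)
        ((continuous_massDensity (hu n).continuous).intervalIntegrable _ _) fun t ht => ?_
      refine mul_le_mul_of_nonneg_right (Real.exp_le_exp.2 ?_) (sinhProd_nonneg hc ht.1)
      have h2 := (hu n).apply_le' ht.1
      have h3 : L n * t ≤ l * 1 := mul_le_mul (hLl n) ht.2 ht.1 hl0.le
      linarith
    rw [← le_div_iff₀ hG] at h1
    have h2 := Real.log_le_log (Real.exp_pos _) h1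
    rw [Real.log_exp] at h2
    linarith
  obtain ⟨φ, hφ, w, hw⟩ := exists_subseq_tendsto_of_lipschitz (f := u) (K := l)
    (B := max |a| |K|) (fun n x y => ((hu n).abs_sub_le x y).trans
      (mul_le_mul_of_nonneg_right (hLl n) (abs_nonneg _)))
    (fun n => abs_le_max_abs_abs (ha n) (hK n))
  have hwc : Continuous w := by
    have hlip : LipschitzWith (Real.toNNReal l) w := LipschitzWith.of_dist_le_mul fun x y => by
      rw [Real.dist_eq, Real.dist_eq, Real.coe_toNNReal l hl0.le]
      refine le_of_tendsto ((hw x).sub (hw y)).abs (Eventually.of_forall fun n => ?_)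
      exact ((hu _).abs_sub_le x y).trans (mul_le_mul_of_nonneg_right (hLl _) (abs_nonneg _))
    exact hlip.continuous
  have hweven (x : ℝ) : w (-x) = w x :=
    tendsto_nhds_unique (hw (-x)) ((hw x).congr fun n => ((hu _).even x).symm)
  have hint (x : ℝ) (hx : 0 ≤ x) : Tendsto (fun n => ∫ t in (0 : ℝ)..x, massDensity S c (u (φ n)) t)
      atTop (𝓝 (∫ t in (0 : ℝ)..x, massDensity S c w t)) := by
    refine intervalIntegral.tendsto_integral_filter_of_dominated_convergence
      (fun t => Real.exp (-(2 * a)) * sinhProd S c t)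
      (Eventually.of_forall fun n =>
        (continuous_massDensity (hu _).continuous).aestronglyMeasurable)
      (Eventually.of_forall fun n => Eventually.of_forall fun t ht => ?_)
      ((hJc.intervalIntegrable _ _).const_mul _)
      (Eventually.of_forall fun t _ => ?_)
    · rw [uIoc_of_le hx] at ht
      rw [Real.norm_of_nonneg (massDensity_nonneg hc _ ht.1.le)]
      refine mul_le_mul_of_nonneg_right (Real.exp_le_exp.2 ?_) (sinhProd_nonneg hc ht.1.le)
      linarith [ha (φ n), (hu (φ n)).le_apply t]
    · exact (((hw t).const_mul 2).neg.rexp).mul_const _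
  have hLφ : Tendsto (fun n => L (φ n)) atTop (𝓝 ℓ) := hL.comp hφ.tendsto_atTop
  -- A cluster point `p` of the derivatives at `x` is a subgradient of `w`, and satisfies the first
  -- integral. The subsequence may depend on `x`, as the subgradient inequality involves one `p`.
  have hp (x : ℝ) (hx : 0 ≤ x) : ∃ p ∈ Icc 0 ℓ, F p =
      (∫ t in (0 : ℝ)..x, massDensity S c w t) ∧ ∀ y, p * (y - x) ≤ w y - w x := by
    obtain ⟨p, hp, ψ, hψ, hlim⟩ :=
      isCompact_Icc.tendsto_subseq fun n => hmem (φ n) hx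
    refine ⟨p, ⟨hp.1, ?_⟩, ?_, fun y => ?_⟩
    · exact le_of_tendsto_of_tendsto' hlim (hLφ.comp hψ.tendsto_atTop)
        fun n => ((hu _).deriv_mem hx).2.le
    · refine tendsto_nhds_unique ((hFc.tendsto p).comp hlim)
        (((hint x hx).comp hψ.tendsto_atTop).congr fun n => ?_)
      exact (hFu _ hx).symm
    · exact le_of_tendsto_of_tendsto' (hlim.mul_const _)
        (((hw y).sub (hw x)).comp hψ.tendsto_atTop) fun n => (hu _).tangent_le x y
  obtain ⟨hsmooth, hconvex, hfirst⟩ := smooth_of_subgradient hc hS hV hV0 hl h₀ hwc hweven hp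
  have hmono : StrictMono (deriv w) := strictMono_of_deriv_pos hconvex
  have hwd (x : ℝ) : HasDerivAt (deriv w) (deriv (deriv w) x) x :=
    (((contDiff_infty_iff_deriv.1 hsmooth).2).differentiable (by simp) x).hasDerivAt
  refine ⟨w, hsmooth, hweven, hconvex, Subset.antisymm ?_ ?_, fun x hx => ?_⟩
  · rintro _ ⟨x, hx, rfl⟩
    refine ⟨(hfirst x hx).1.1, (hmono (lt_add_one x)).trans_le (hfirst (x + 1) ?_).1.2⟩
    have : 0 ≤ x := hx
    linarith
  · intro q hq
    -- No mass escapes to infinity, hence `u'` reaches every value below `ℓ`.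
    obtain ⟨q', hqq', hq'ℓ⟩ := exists_between hq.2
    have hqmem : q ∈ Icc 0 l := ⟨hq.1, (hq.2.trans hl).le⟩
    have hq'mem : q' ∈ Icc 0 l := ⟨hq.1.trans hqq'.le, (hq'ℓ.trans hl).le⟩
    have hFq : F q < F q' := hFmono hqmem hq'mem hqq'
    have hFl : 0 ≤ F l := by
      rw [← hF0]
      exact hFmono.monotoneOn ⟨le_rfl, hl0.le⟩ ⟨hl0.le, le_rfl⟩ hl0.le
    obtain ⟨R, hR, htail⟩ := exists_tail_le (S := S) (c := c) (V := V) hc (a := a) (b := K) (l := l)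
      (M := F l) (η := (F q' - F q) / 2) hFl (by linarith)
    have hlow : ∀ᶠ n in atTop, F q' - (F q' - F q) / 2 ≤
        ∫ t in (0 : ℝ)..R, massDensity S c (u (φ n)) t := by
      filter_upwards [hLφ.eventually (lt_mem_nhds hq'ℓ)] with n hn
      obtain ⟨X, hX, hXq⟩ := (hu (φ n)).exists_deriv_eq ⟨hq'mem.1, hn⟩
      rcases le_total R X with hRX | hRX
      · have h1 := htail _ _ (hu (φ n)) (hLl _) (ha _) (hK _) (hmass (φ n)) X hRX
        rw [← hFu _ hX, hXq] at h1
        linarith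
      · have h1 := hFmono.monotoneOn (hmem (φ n) hX) (hmem (φ n) hR.le)
          ((hu (φ n)).strictMono.monotone hRX)
        rw [hXq, hFu _ hR.le] at h1
        linarith
    have h1 := ge_of_tendsto (hint R hR.le) hlow
    rw [← (hfirst R hR.le).2] at h1
    have hRmem : deriv w R ∈ Icc 0 l := ⟨(hfirst R hR.le).1.1, (hfirst R hR.le).1.2.trans hl.le⟩
    have hqR : q ≤ deriv w R := by
      by_contra hlt
      push Not at hlt
      have h2 : F (deriv w R) < F q := hFmono hRmem hqmem hlt
      have h3 : F q' - (F q' - F q) / 2 ≤ F (deriv w R) := h1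
      linarith
    have hd0 : deriv w 0 = 0 := by
      have := deriv_neg_of_even hweven 0
      rw [neg_zero] at this
      linarith
    obtain ⟨x, hx, hxq⟩ := intermediate_value_Icc hR.le
      (f := deriv w) (fun x _ => (hwd x).continuousAt.continuousWithinAt) ⟨hd0.symm ▸ hq.1, hqR⟩
    exact ⟨x, hx.1, hxq⟩
  · have h1 : HasDerivAt (fun x => F (deriv w x)) (V (deriv w x) * deriv (deriv w) x) x :=
      (intervalIntegral.integral_hasDerivAt_right (hV.intervalIntegrable _ _)
        (hV.stronglyMeasurableAtFilter _ _) hV.continuousAt :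
          HasDerivAt F (V (deriv w x)) (deriv w x)).comp x (hwd x)
    have h2 := hasDerivAt_integral_massDensity (S := S) (c := c) hwc x
    have h3 : (fun x => F (deriv w x)) =ᶠ[𝓝 x] fun x => ∫ t in (0 : ℝ)..x, massDensity S c w t := by
      filter_upwards [lt_mem_nhds hx] with y hy
      exact (hfirst y (le_of_lt hy)).2
    rw [mul_comm]
    exact h1.unique (h2.congr_of_eventuallyEq h3)

/-! ### The limit equation and the blow-up -/

/-- The even solution `w`, with `w(0) = 0`, of `(w' ^ (Card S + 1))' = A J`. -/
def limitPotential (S : Finset ι) (c : ι → ℝ) (A x : ℝ) : ℝ :=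
  ∫ t in (0 : ℝ)..x, radialRoot S.card (fun t => A * sinhProdCore S c t) t

section limitPotential

variable {A : ℝ}

theorem contDiff_const_mul_core (n : ℕ) : ContDiff ℝ n fun t => A * sinhProdCore S c t :=
  contDiff_const.mul (contDiff_sinhProdCore S c n)

theorem const_mul_core_pos (hc : ∀ i ∈ S, 0 < c i) (hA : 0 < A) (x : ℝ) :
    0 < A * sinhProdCore S c x :=
  mul_pos hA (sinhProdCore_pos hc x)

theorem contDiff_limitRoot (hc : ∀ i ∈ S, 0 < c i) (hA : 0 < A) (n : ℕ) :
    ContDiff ℝ n (radialRoot S.card fun t => A * sinhProdCore S c t) :=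
  contDiff_radialRoot (contDiff_const_mul_core n) (const_mul_core_pos hc hA)

theorem hasDerivAt_limitPotential (hc : ∀ i ∈ S, 0 < c i) (hA : 0 < A) (x : ℝ) :
    HasDerivAt (limitPotential S c A)
      (radialRoot S.card (fun t => A * sinhProdCore S c t) x) x := by
  have h := (contDiff_limitRoot hc hA 0).continuous
  exact intervalIntegral.integral_hasDerivAt_right (h.intervalIntegrable _ _)
    (h.stronglyMeasurableAtFilter _ _) h.continuousAt

theorem deriv_limitPotential (hc : ∀ i ∈ S, 0 < c i) (hA : 0 < A) :
    deriv (limitPotential S c A) = radialRoot S.card fun t => A * sinhProdCore S c t :=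
  funext fun x => (hasDerivAt_limitPotential hc hA x).deriv

theorem contDiff_limitPotential (hc : ∀ i ∈ S, 0 < c i) (hA : 0 < A) :
    ContDiff ℝ ∞ (limitPotential S c A) := by
  rw [contDiff_infty_iff_deriv, deriv_limitPotential hc hA]
  exact ⟨fun x => (hasDerivAt_limitPotential hc hA x).differentiableAt,
    contDiff_infty.2 (contDiff_limitRoot hc hA)⟩

theorem limitPotential_even (x : ℝ) : limitPotential S c A (-x) = limitPotential S c A x := by
  have h := intervalIntegral.integral_comp_neg (a := 0) (b := x)
    (radialRoot S.card fun t => A * sinhProdCore S c t)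
  have hodd (t : ℝ) : radialRoot S.card (fun t => A * sinhProdCore S c t) (-t) =
      -radialRoot S.card (fun t => A * sinhProdCore S c t) t :=
    radialRoot_neg (fun t => by rw [sinhProdCore_even]) t
  simp only [hodd, intervalIntegral.integral_neg, neg_zero] at h
  rw [limitPotential, limitPotential, intervalIntegral.integral_symm, ← h, neg_neg]

theorem deriv_deriv_limitPotential_pos (hc : ∀ i ∈ S, 0 < c i) (hA : 0 < A) (x : ℝ) :
    0 < deriv (deriv (limitPotential S c A)) x := by
  rw [deriv_limitPotential hc hA]
  exact deriv_radialRoot_pos (by exact_mod_cast contDiff_const_mul_core (S := S) (c := c) 1)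
    (const_mul_core_pos hc hA) x

theorem limitPotential_equation (hc : ∀ i ∈ S, 0 < c i) (hA : 0 < A) (x : ℝ) :
    (S.card + 1) * deriv (limitPotential S c A) x ^ S.card *
      deriv (deriv (limitPotential S c A)) x = A * sinhProd S c x := by
  rw [deriv_limitPotential hc hA, radialRoot_pow_mul_deriv
    (by exact_mod_cast contDiff_const_mul_core (S := S) (c := c) 1) (const_mul_core_pos hc hA),
    sinhProd_eq]
  ring

theorem hasDerivAt_deriv_limitPotential_pow (hc : ∀ i ∈ S, 0 < c i) (hA : 0 < A) (x : ℝ) :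
    HasDerivAt (fun x => deriv (limitPotential S c A) x ^ (S.card + 1)) (A * sinhProd S c x) x := by
  rw [deriv_limitPotential hc hA]
  refine (hasDerivAt_radialRoot_pow (contDiff_const_mul_core 0).continuous
    (const_mul_core_pos hc hA) x).congr_deriv ?_
  rw [sinhProd_eq]
  ring

theorem deriv_limitPotential_zero (hc : ∀ i ∈ S, 0 < c i) (hA : 0 < A) :
    deriv (limitPotential S c A) 0 = 0 := by
  rw [deriv_limitPotential hc hA, radialRoot_zero]

theorem deriv_limitPotential_strictMono (hc : ∀ i ∈ S, 0 < c i) (hA : 0 < A) :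
    StrictMono (deriv (limitPotential S c A)) :=
  strictMono_of_deriv_pos (deriv_deriv_limitPotential_pos hc hA)

theorem deriv_limitPotential_pos (hc : ∀ i ∈ S, 0 < c i) (hA : 0 < A) {x : ℝ} (hx : 0 < x) :
    0 < deriv (limitPotential S c A) x := by
  rw [← deriv_limitPotential_zero hc hA]
  exact deriv_limitPotential_strictMono hc hA hx

/-- Since `J' ≥ (∑ cᵢ) J`, the function `w' ^ (Card S + 1) / A = ∫ J` is at most `J / ∑ cᵢ`. -/
theorem sum_mul_deriv_pow_le (hc : ∀ i ∈ S, 0 < c i) (hS : S.Nonempty) (hA : 0 < A) {x : ℝ}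
    (hx : 0 ≤ x) :
    (∑ i ∈ S, c i) * deriv (limitPotential S c A) x ^ (S.card + 1) ≤ A * sinhProd S c x := by
  have hd (y : ℝ) (hy : 0 < y) : HasDerivAt (fun y => A * sinhProd S c y -
      (∑ i ∈ S, c i) * deriv (limitPotential S c A) y ^ (S.card + 1))
      (A * (sinhProd S c y * sinhProdLogDeriv S c y) - (∑ i ∈ S, c i) * (A * sinhProd S c y)) y :=
    ((hasDerivAt_sinhProd hc hy).const_mul A).fun_sub
      ((hasDerivAt_deriv_limitPotential_pow hc hA y).const_mul _)
  have hmono : MonotoneOn (fun y => A * sinhProd S c y -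
      (∑ i ∈ S, c i) * deriv (limitPotential S c A) y ^ (S.card + 1)) (Ici 0) := by
    refine monotoneOn_of_deriv_nonneg (convex_Ici 0) ?_ (fun y hy => ?_) fun y hy => ?_
    · have h1 := continuous_sinhProd S c
      have h2 : Continuous (deriv (limitPotential S c A)) :=
        (contDiff_infty_iff_deriv.1 (contDiff_limitPotential hc hA)).2.continuous
      fun_prop
    · rw [interior_Ici] at hy
      exact (hd y hy).differentiableAt.differentiableWithinAt
    · rw [interior_Ici] at hy
      rw [(hd y hy).deriv]
      have h1 := sum_le_sinhProdLogDeriv hc hy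
      have h2 : 0 < A * sinhProd S c y := mul_pos hA (sinhProd_pos hc hy)
      nlinarith
  have h := hmono (mem_Ici.2 le_rfl) (mem_Ici.2 hx) hx
  simp only [sinhProd_zero hS, deriv_limitPotential_zero hc hA] at h
  simp only [mul_zero, ne_eq, Nat.add_eq_zero_iff, one_ne_zero, and_false, not_false_eq_true,
    zero_pow, sub_zero] at h
  linarith

/-- Completeness: `w''` is bounded below at infinity. -/
theorem tendsto_integral_sqrt_limitPotential (hc : ∀ i ∈ S, 0 < c i) (hS : S.Nonempty)
    (hA : 0 < A) :
    Tendsto (fun R : ℝ => ∫ x in (0 : ℝ)..R, Real.sqrt (deriv (deriv (limitPotential S c A)) x))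
      atTop atTop := by
  set w := limitPotential S c A with hw
  set B := ∑ i ∈ S, c i with hB
  have hBpos : 0 < B := Finset.sum_pos hc hS
  set κ := B * deriv w 1 / (S.card + 1) with hκ
  have hκpos : 0 < κ := by
    have := deriv_limitPotential_pos hc hA one_pos
    positivity
  have hlow (x : ℝ) (hx : 1 ≤ x) : κ ≤ deriv (deriv w) x := by
    have hx0 : 0 < x := by linarith
    have hpos := deriv_limitPotential_pos hc hA hx0
    have h1 := limitPotential_equation hc hA x
    have h2 := sum_mul_deriv_pow_le hc hS hA hx0.le
    have h3 : B * deriv w x ≤ (S.card + 1) * deriv (deriv w) x := by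
      refine le_of_mul_le_mul_left ?_ (pow_pos hpos S.card)
      calc deriv w x ^ S.card * (B * deriv w x) = B * deriv w x ^ (S.card + 1) := by ring
        _ ≤ A * sinhProd S c x := h2
        _ = deriv w x ^ S.card * ((S.card + 1) * deriv (deriv w) x) := by rw [← h1]; ring
    have h4 := (deriv_limitPotential_strictMono hc hA).monotone hx
    rw [hκ, div_le_iff₀ (by positivity)]
    calc B * deriv w 1 ≤ B * deriv w x := by gcongr
      _ ≤ deriv (deriv w) x * (S.card + 1) := by linarith
  have hcont : Continuous fun x => Real.sqrt (deriv (deriv w) x) := by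
    have h1 := (contDiff_infty_iff_deriv.1 (contDiff_limitPotential hc hA)).2
    exact (contDiff_infty_iff_deriv.1 h1).2.continuous.sqrt
  have hlim : Tendsto (fun R : ℝ => Real.sqrt κ * (R - 1)) atTop atTop :=
    (tendsto_atTop_add_const_right atTop (-1) tendsto_id).const_mul_atTop (Real.sqrt_pos.2 hκpos)
  refine tendsto_atTop_mono' atTop ?_ hlim
  filter_upwards [eventually_ge_atTop 1] with R hR
  rw [← intervalIntegral.integral_add_adjacent_intervals (hcont.intervalIntegrable 0 1)
    (hcont.intervalIntegrable 1 R)]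
  have h1 : 0 ≤ ∫ x in (0 : ℝ)..1, Real.sqrt (deriv (deriv w) x) :=
    intervalIntegral.integral_nonneg zero_le_one fun _ _ => Real.sqrt_nonneg _
  have h2 : ∫ _ in (1 : ℝ)..R, Real.sqrt κ ≤ ∫ x in (1 : ℝ)..R, Real.sqrt (deriv (deriv w) x) :=
    intervalIntegral.integral_mono_on hR (by simp) (hcont.intervalIntegrable _ _)
      fun x hx => Real.sqrt_le_sqrt (hlow x hx.1)
  rw [intervalIntegral.integral_const, smul_eq_mul, mul_comm] at h2
  linarith

end limitPotential

/-- If two functions vanishing at `0` satisfy `f' ≤ g'` on `[0, R]`, then `f ≤ g` there. -/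
theorem le_of_hasDerivAt_le {f g f' g' : ℝ → ℝ} {R : ℝ} (hf : ∀ x, HasDerivAt f (f' x) x)
    (hg : ∀ x, HasDerivAt g (g' x) x) (h0 : f 0 = g 0) (hle : ∀ x ∈ Ioo 0 R, f' x ≤ g' x) {x : ℝ}
    (hx : x ∈ Icc 0 R) : f x ≤ g x := by
  have hmono : MonotoneOn (fun x => g x - f x) (Icc 0 R) := by
    refine monotoneOn_of_deriv_nonneg (convex_Icc 0 R)
      (fun y _ => ((hg y).fun_sub (hf y)).continuousAt.continuousWithinAt)
      (fun y _ => ((hg y).fun_sub (hf y)).differentiableAt.differentiableWithinAt) fun y hy => ?_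
    rw [interior_Icc] at hy
    rw [((hg y).fun_sub (hf y)).deriv]
    exact sub_nonneg.2 (hle y hy)
  have h := hmono ⟨le_rfl, hx.1.trans hx.2⟩ hx hx.1
  simp only [h0] at h
  linarith

/-- The rescaling of a potential which normalizes the blow-up. -/
def blowup (r : ℕ) (u : ℝ → ℝ) (x : ℝ) : ℝ := Real.exp (2 * u 0 / ((r : ℝ) + 1)) * (u x - u 0)

/-- One potential is close to the limit after rescaling as soon as the coefficients of
the two equations are close: the densities of `(ū' ^ (r + 1))'` and `(w' ^ (r + 1))'` have a ratio
close to `1`. -/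
theorem abs_blowup_sub_le (hc : ∀ i ∈ S, 0 < c i) {N : ℝ → ℝ} (hN0 : 0 < N 0) {L : ℝ} {u : ℝ → ℝ}
    (hu : IsPotential S c (fun p => p ^ S.card * N p) L u) {R δ : ℝ} (hδ : 0 ≤ δ) (hδ1 : δ ≤ 1)
    (hclose : ∀ x ∈ Ioo 0 R, 0 < N (deriv u x) ∧
      (1 - δ) ^ (S.card + 1) * N (deriv u x) ≤ Real.exp (-(2 * (u x - u 0))) * N 0 ∧
      Real.exp (-(2 * (u x - u 0))) * N 0 ≤ (1 + δ) ^ (S.card + 1) * N (deriv u x)) {x : ℝ}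
    (hx : x ∈ Icc 0 R) :
    |blowup S.card u x - limitPotential S c ((S.card + 1) / N 0) x| ≤
      δ * limitPotential S c ((S.card + 1) / N 0) x := by
  set r := S.card with hr
  set A : ℝ := ((r : ℝ) + 1) / N 0 with hA
  have hApos : 0 < A := by positivity
  set w := limitPotential S c A with hw
  set a := Real.exp (2 * u 0 / ((r : ℝ) + 1)) with ha
  have hapos : 0 < a := Real.exp_pos _
  have hapow : a ^ (r + 1) = Real.exp (2 * u 0) := by
    rw [ha, ← Real.exp_nat_mul]
    congr 1
    push_cast
    field_simp
  have hE (y : ℝ) : HasDerivAt (fun y => (a * deriv u y) ^ (r + 1))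
      ((r + 1) * (Real.exp (2 * u 0) * (deriv u y ^ r * deriv (deriv u) y))) y := by
    refine (((hu.hasDerivAt_deriv y).const_mul a).fun_pow (r + 1)).congr_deriv ?_
    rw [← hapow]
    push_cast
    ring
  have hEw (y : ℝ) : HasDerivAt (fun y => deriv w y ^ (r + 1)) (A * sinhProd S c y) y :=
    hasDerivAt_deriv_limitPotential_pow hc hApos y
  have hid (y : ℝ) (hy : 0 < y) :
      (r + 1) * (Real.exp (2 * u 0) * (deriv u y ^ r * deriv (deriv u) y)) * N (deriv u y) =
        Real.exp (-(2 * (u y - u 0))) * N 0 * (A * sinhProd S c y) := by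
    have h1 := hu.ode y hy
    have h2 : Real.exp (-(2 * (u y - u 0))) = Real.exp (2 * u 0) * Real.exp (-(2 * u y)) := by
      rw [← Real.exp_add]
      congr 1
      ring
    have h3 : N 0 * A = r + 1 := by
      rw [hA]
      field_simp
    rw [h2]
    linear_combination (r + 1) * Real.exp (2 * u 0) * h1 -
      Real.exp (2 * u 0) * Real.exp (-(2 * u y)) * sinhProd S c y * h3
  have hJ (y : ℝ) (hy : 0 < y) : 0 < A * sinhProd S c y := mul_pos hApos (sinhProd_pos hc hy)
  have hw0 (y : ℝ) (hy : 0 ≤ y) : 0 ≤ deriv w y := by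
    rw [← deriv_limitPotential_zero hc hApos]
    exact (deriv_limitPotential_strictMono hc hApos).monotone hy
  have hd0 := deriv_limitPotential_zero hc hApos
  have hup (y : ℝ) (hy : y ∈ Icc 0 R) : a * deriv u y ≤ (1 + δ) * deriv w y := by
    refine (pow_le_pow_iff_left₀ (mul_nonneg hapos.le (hu.deriv_mem hy.1).1)
      (mul_nonneg (by linarith) (hw0 y hy.1)) (Nat.succ_ne_zero r)).1 ?_
    rw [mul_pow (1 + δ)]
    refine le_of_hasDerivAt_le hE (fun z => (hEw z).const_mul ((1 + δ) ^ (r + 1))) ?_ ?_ hy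
    · simp [hu.deriv_zero, hd0, hw]
    · intro z hz
      obtain ⟨h1, -, h3⟩ := hclose z hz
      refine le_of_mul_le_mul_right ?_ h1
      rw [hid z hz.1]
      nlinarith [hJ z hz.1]
  have hlo (y : ℝ) (hy : y ∈ Icc 0 R) : (1 - δ) * deriv w y ≤ a * deriv u y := by
    refine (pow_le_pow_iff_left₀ (mul_nonneg (by linarith) (hw0 y hy.1))
      (mul_nonneg hapos.le (hu.deriv_mem hy.1).1) (Nat.succ_ne_zero r)).1 ?_
    rw [mul_pow (1 - δ)]
    refine le_of_hasDerivAt_le (fun z => (hEw z).const_mul ((1 - δ) ^ (r + 1))) hE ?_ ?_ hy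
    · simp [hu.deriv_zero, hd0, hw]
    · intro z hz
      obtain ⟨h1, h2, -⟩ := hclose z hz
      refine le_of_mul_le_mul_right ?_ h1
      rw [hid z hz.1]
      nlinarith [hJ z hz.1]
  have hū (y : ℝ) : HasDerivAt (blowup r u) (a * deriv u y) y :=
    ((hu.hasDerivAt y).sub_const (u 0)).const_mul a
  have hwd (y : ℝ) : HasDerivAt w (deriv w y) y :=
    (hasDerivAt_limitPotential hc hApos y).differentiableAt.hasDerivAt
  have hū0 : blowup r u 0 = 0 := by simp [blowup]
  have hwz : w 0 = 0 := intervalIntegral.integral_same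
  have h1 := le_of_hasDerivAt_le hū (fun z => (hwd z).const_mul (1 + δ)) (by simp [hū0, hwz])
    (fun z hz => hup z ⟨hz.1.le, hz.2.le⟩) hx
  have h2 := le_of_hasDerivAt_le (fun z => (hwd z).const_mul (1 - δ)) hū (by simp [hū0, hwz])
    (fun z hz => hlo z ⟨hz.1.le, hz.2.le⟩) hx
  rw [abs_le]
  constructor <;> linarith

/-- Blow-up: if `uₙ(0) → ∞`, then the rescaled potentials converge to the solution of
the limit equation. -/
theorem tendstoLocallyUniformly_blowup (hc : ∀ i ∈ S, 0 < c i) (hS : S.Nonempty) {N : ℝ → ℝ}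
    (hN : Continuous N) {l : ℝ} {u₀ : ℝ → ℝ}
    (h₀ : IsPotential S c (fun p => p ^ S.card * N p) l u₀) {u : ℕ → ℝ → ℝ} {L : ℕ → ℝ}
    (hu : ∀ n, IsPotential S c (fun p => p ^ S.card * N p) (L n) (u n)) (hLl : ∀ n, L n ≤ l)
    (hinf : Tendsto (fun n => u n 0) atTop atTop) :
    TendstoLocallyUniformly (fun n => blowup S.card (u n))
      (limitPotential S c ((S.card + 1) / N 0)) atTop := by
  have hN0 : 0 < N 0 := h₀.core_pos hc hN
  have hApos : (0 : ℝ) < (S.card + 1) / N 0 := by positivity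
  set w := limitPotential S c ((S.card + 1) / N 0) with hw
  have hV : Continuous fun p => p ^ S.card * N p := by fun_prop
  have hV0 : (0 : ℝ) ^ S.card * N 0 = 0 := by rw [zero_pow hS.card_ne_zero, zero_mul]
  set F : ℝ → ℝ := fun q => ∫ p in (0 : ℝ)..q, p ^ S.card * N p with hF
  have hFmono : StrictMonoOn F (Icc 0 l) := h₀.strictMonoOn_integral hc hV
  have hl0 : 0 < l := h₀.pos
  have hJc := continuous_sinhProd S c
  -- The derivatives tend to zero, since so does the mass of `[0, R]`.
  have hderiv (R : ℝ) (hR : 0 ≤ R) (τ : ℝ) (hτ : 0 < τ) : ∀ᶠ n in atTop, deriv (u n) R < τ := by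
    have hτ' : 0 < min τ l := lt_min hτ hl0
    have hFτ : 0 < F (min τ l) := by
      have := hFmono ⟨le_rfl, hl0.le⟩ ⟨hτ'.le, min_le_right _ _⟩ hτ'
      simpa [hF] using this
    have hlim : Tendsto (fun n => Real.exp (-(2 * u n 0)) * ∫ t in (0 : ℝ)..R, sinhProd S c t)
        atTop (𝓝 0) := by
      have h1 : Tendsto (fun n => -(2 * u n 0)) atTop atBot :=
        tendsto_neg_atTop_atBot.comp (hinf.const_mul_atTop two_pos)
      simpa using (Real.tendsto_exp_atBot.comp h1).mul_const (∫ t in (0 : ℝ)..R, sinhProd S c t)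
    filter_upwards [hlim.eventually (gt_mem_nhds hFτ)] with n hn
    have hle : F (deriv (u n) R) ≤ Real.exp (-(2 * u n 0)) * ∫ t in (0 : ℝ)..R, sinhProd S c t := by
      rw [show F (deriv (u n) R) = _ from (hu n).integral_eq hS hV hV0 hR,
        ← intervalIntegral.integral_const_mul]
      refine intervalIntegral.integral_mono_on hR
        ((continuous_massDensity (hu n).continuous).intervalIntegrable _ _)
        ((hJc.intervalIntegrable _ _).const_mul _) fun t ht => ?_
      refine mul_le_mul_of_nonneg_right (Real.exp_le_exp.2 ?_) (sinhProd_nonneg hc ht.1)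
      linarith [(hu n).le_apply t]
    by_contra hlt
    push Not at hlt
    have h1 := (hu n).deriv_mem hR
    have h2 := hFmono.monotoneOn ⟨hτ'.le, min_le_right _ _⟩ ⟨h1.1, h1.2.le.trans (hLl n)⟩
      ((min_le_left _ _).trans hlt)
    linarith
  have hunif (R : ℝ) (hR : 0 ≤ R) (δ : ℝ) (hδ : 0 < δ) (hδ1 : δ ≤ 1) : ∀ᶠ n in atTop,
      ∀ x ∈ Icc 0 R, |blowup S.card (u n) x - w x| ≤ δ * w x := by
    have hcont1 : Continuous fun q : ℝ × ℝ =>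
        Real.exp (-(2 * q.2)) * N 0 - (1 - δ) ^ (S.card + 1) * N q.1 := by fun_prop
    have hcont2 : Continuous fun q : ℝ × ℝ =>
        (1 + δ) ^ (S.card + 1) * N q.1 - Real.exp (-(2 * q.2)) * N 0 := by fun_prop
    have hcont3 : Continuous fun q : ℝ × ℝ => N q.1 := by fun_prop
    have hlt1 : (1 - δ) ^ (S.card + 1) < 1 :=
      pow_lt_one₀ (by linarith) (by linarith) (Nat.succ_ne_zero _)
    have hlt2 : 1 < (1 + δ) ^ (S.card + 1) := one_lt_pow₀ (by linarith) (Nat.succ_ne_zero _)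
    have hev : ∀ᶠ q in 𝓝 ((0, 0) : ℝ × ℝ),
        0 < Real.exp (-(2 * q.2)) * N 0 - (1 - δ) ^ (S.card + 1) * N q.1 ∧
        0 < (1 + δ) ^ (S.card + 1) * N q.1 - Real.exp (-(2 * q.2)) * N 0 ∧ 0 < N q.1 := by
      refine (hcont1.continuousAt.eventually (lt_mem_nhds ?_)).and
        ((hcont2.continuousAt.eventually (lt_mem_nhds ?_)).and
          (hcont3.continuousAt.eventually (lt_mem_nhds hN0)))
      · simp only [mul_zero, neg_zero, Real.exp_zero, one_mul]
        nlinarith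
      · simp only [mul_zero, neg_zero, Real.exp_zero, one_mul]
        nlinarith
    obtain ⟨η, hη, hball⟩ := Metric.eventually_nhds_iff.1 hev
    filter_upwards [hderiv R hR (η / (R + 1)) (by positivity)] with n hn x hx
    refine abs_blowup_sub_le hc hN0 (hu n) hδ.le hδ1 (fun y hy => ?_) hx
    have h1 : deriv (u n) y < η / (R + 1) :=
      ((hu n).strictMono.monotone hy.2.le).trans_lt hn
    have h2 := (hu n).deriv_pos hy.1
    rw [lt_div_iff₀ (by linarith)] at h1
    have h3 : deriv (u n) y < η := by nlinarith
    have h4 : u n y - u n 0 < η := by nlinarith [(hu n).apply_le (x := y), hy.1, hy.2]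
    have h5 : 0 ≤ u n y - u n 0 := sub_nonneg.2 ((hu n).le_apply y)
    obtain ⟨k1, k2, k3⟩ := @hball (deriv (u n) y, u n y - u n 0) (by
      rw [Prod.dist_eq, Real.dist_eq, Real.dist_eq, sub_zero, sub_zero, abs_of_pos h2,
        abs_of_nonneg h5]
      exact max_lt h3 h4)
    exact ⟨k3, (sub_pos.1 k1).le, (sub_pos.1 k2).le⟩
  rw [Metric.tendstoLocallyUniformly_iff]
  intro ε hε x
  set R := |x| + 1 with hR
  have hR0 : 0 ≤ R := by positivity
  have hwmono (y : ℝ) (hy : y ∈ Icc 0 R) : w y ≤ w R := by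
    have : MonotoneOn w (Icc 0 R) := by
      refine monotoneOn_of_deriv_nonneg (convex_Icc 0 R)
        (contDiff_limitPotential hc hApos).continuous.continuousOn
        ((contDiff_limitPotential hc hApos).differentiable (by simp)).differentiableOn
        fun z hz => ?_
      rw [interior_Icc] at hz
      exact (deriv_limitPotential_pos hc hApos hz.1).le
    exact this hy ⟨hR0, le_rfl⟩ hy.2
  have hwR : 0 ≤ w R := by
    have h := hwmono 0 ⟨le_rfl, hR0⟩
    rwa [show w 0 = 0 from intervalIntegral.integral_same] at h
  set δ := min 1 (ε / (2 * (w R + 1))) with hδ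
  have hδ0 : 0 < δ := lt_min one_pos (by positivity)
  have hδε : δ * w R < ε := by
    calc δ * w R ≤ ε / (2 * (w R + 1)) * w R := by gcongr; exact min_le_right _ _
      _ ≤ ε / (2 * (w R + 1)) * (w R + 1) := by gcongr; linarith
      _ = ε / 2 := by field_simp
      _ < ε := by linarith
  refine ⟨Icc (-R) R, Icc_mem_nhds ?_ ?_, ?_⟩
  · linarith [neg_abs_le x]
  · linarith [le_abs_self x]
  filter_upwards [hunif R hR0 δ hδ0 (min_le_left _ _)] with n hn y hy
  have hmain (z : ℝ) (hz : z ∈ Icc 0 R) : dist (w z) (blowup S.card (u n) z) < ε := by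
    rw [dist_comm, Real.dist_eq]
    refine (hn z hz).trans_lt (lt_of_le_of_lt ?_ hδε)
    exact mul_le_mul_of_nonneg_left (hwmono z hz) hδ0.le
  rcases le_total 0 y with h | h
  · exact hmain y ⟨h, hy.2⟩
  · have h1 := hmain (-y) ⟨by linarith, by linarith [hy.1]⟩
    rwa [hw, limitPotential_even, blowup, (hu n).even] at h1

end StenzelLimit

/-! ### Horosymmetric data -/

namespace HorosymmetricDatum

open StenzelLimit

variable {𝔤 : Type*} [LieRing 𝔤] [LieAlgebra ℂ 𝔤] [FiniteDimensional ℂ 𝔤]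
  [LieAlgebra.IsKilling ℂ 𝔤] {𝔱 : LieSubalgebra ℂ 𝔤} [𝔱.IsCartanSubalgebra]
  {D : HorosymmetricDatum 𝔤 𝔱} {γ : Module.Dual ℂ 𝔱} {γs : 𝔱}

variable (D γ) in
/-- The factor `v(p) / pʳ` of the Duistermaat-Heckman density. -/
def vCore (p : ℝ) : ℝ :=
  (∏ β ∈ D.rootsS, killingDual (β : 𝔱 →ₗ[ℂ] ℂ) γ) *
    ∏ α ∈ D.rootsQu, killingDual (α : 𝔱 →ₗ[ℂ] ℂ) (D.chiH - (p : ℂ) • γ)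

theorem v_eq (p : ℝ) : D.v γ p = p ^ D.rootsS.card * D.vCore γ p := by
  have h := D.v₀_eq (γ := γ) p
  rw [v₀] at h
  rw [v, h, vCore, r, mul_assoc]

theorem continuous_vCore : Continuous (D.vCore γ) := by
  unfold vCore
  simp only [killingDual_sub_smul]
  fun_prop

variable (γs) in
/-- The coefficients `2 β(γ*)` in `J`. -/
def exponent (β : Weight ℂ 𝔱 𝔤) : ℝ := 2 * (β γs).re

theorem J_eq : D.J γs = sinhProd D.rootsS (exponent γs) := rfl

theorem isKEPotential_iff (hc : ∀ β ∈ D.rootsS, 0 < exponent γs β) (s : ℝ) (u : ℝ → ℝ) :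
    D.IsKEPotential γ γs s u ↔ IsPotential D.rootsS (exponent γs)
      (fun p => p ^ D.rootsS.card * D.vCore γ p) (D.lambdaAc γs - s) u := by
  have hexp (x : ℝ) (hx : 0 < x) : Real.exp (-(2 * u x + D.j γs x)) =
      Real.exp (-(2 * u x)) * sinhProd D.rootsS (exponent γs) x := by
    rw [j, J_eq, neg_add, neg_neg, Real.exp_add, Real.exp_log (sinhProd_pos hc hx)]
  constructor
  · rintro ⟨h1, h2, h3, h4, h5⟩
    exact ⟨h1, h2, h3, h4, fun x hx => by rw [← hexp x hx, ← h5 x hx, v_eq]⟩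
  · rintro ⟨h1, h2, h3, h4, h5⟩
    exact ⟨h1, h2, h3, h4, fun x hx => by rw [hexp x hx, ← h5 x hx, v_eq]⟩

/-- As `s → b` the potentials are unbounded at the origin, since a limit would be a potential for
`s = b`. -/
theorem tendsto_apply_zero_atTop (hD : D.IsRankOne) (hγ : D.IsRestrictedGenerator γ γs) {b : ℝ}
    (hb_pos : 0 < b) (hb : {s : ℝ | 0 ≤ s ∧ ∃ w : ℝ → ℝ, D.IsKEPotential γ γs s w} = Ico 0 b)
    {u : ℝ → ℝ → ℝ} (hu : ∀ s ∈ Ico 0 b, D.IsKEPotential γ γs s (u s)) {s : ℕ → ℝ}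
    (hs : ∀ n, s n ∈ Ico 0 b) (hsb : Tendsto s atTop (𝓝 b)) :
    Tendsto (fun n => u (s n) 0) atTop atTop := by
  have hc (β) (hβ : β ∈ D.rootsS) : 0 < exponent γs β :=
    mul_pos two_pos (hD.rootsS_pos hγ hβ)
  by_contra hcon
  rw [tendsto_atTop] at hcon
  push Not at hcon
  obtain ⟨K, hK⟩ := hcon
  obtain ⟨ψ, hψ, hψK⟩ := extraction_of_frequently_atTop hK
  obtain ⟨w, hw⟩ := exists_isPotential_of_tendsto (l := D.lambdaAc γs - 0)
    (ℓ := D.lambdaAc γs - b) (K := K) hc hD.not_toral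
    (V := fun p => p ^ D.rootsS.card * D.vCore γ p)
    ((continuous_id.pow _).mul continuous_vCore)
    (by rw [zero_pow hD.not_toral.card_ne_zero, zero_mul]) (by linarith)
    ((isKEPotential_iff hc 0 _).1 (hu 0 ⟨le_rfl, hb_pos⟩))
    (u := fun n => u (s (ψ n))) (L := fun n => D.lambdaAc γs - s (ψ n))
    (fun n => (isKEPotential_iff hc _ _).1 (hu _ (hs _)))
    (fun n => by linarith [(hs (ψ n)).1])
    ((hsb.comp hψ.tendsto_atTop).const_sub _) fun n => (hψK n).le
  have hmem : b ∈ {s : ℝ | 0 ≤ s ∧ ∃ w : ℝ → ℝ, D.IsKEPotential γ γs s w} :=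
    ⟨hb_pos.le, w, (isKEPotential_iff hc _ _).2 hw⟩
  rw [hb] at hmem
  exact lt_irrefl b hmem.2

end HorosymmetricDatum

open StenzelLimit HorosymmetricDatum in
theorem mainTheorem2 {𝔤 : Type*} [LieRing 𝔤] [LieAlgebra ℂ 𝔤] [FiniteDimensional ℂ 𝔤]
    [LieAlgebra.IsKilling ℂ 𝔤] {𝔱 : LieSubalgebra ℂ 𝔤} [𝔱.IsCartanSubalgebra]
    (D : HorosymmetricDatum 𝔤 𝔱) (hD : D.IsRankOne)
    (γ : Module.Dual ℂ 𝔱) (γs : 𝔱) (hγ : D.IsRestrictedGenerator γ γs)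
    (b : ℝ) (hb_pos : 0 < b)
    (hb : {s : ℝ | 0 ≤ s ∧ ∃ w : ℝ → ℝ, D.IsKEPotential γ γs s w} = Ico 0 b)
    (u : ℝ → ℝ → ℝ) (hu : ∀ s ∈ Ico 0 b, D.IsKEPotential γ γs s (u s)) :
    ∀ s : ℕ → ℝ, (∀ n, s n ∈ Ico 0 b) → Tendsto s atTop (𝓝 b) →
      ∃ φ : ℕ → ℕ, StrictMono φ ∧ ∃ w : ℝ → ℝ,
        TendstoLocallyUniformly (fun n => D.rescale (u (s (φ n)))) w atTop ∧
        ContDiff ℝ 2 w ∧ (∀ x, w (-x) = w x) ∧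
        (∃ C : ℝ, 0 < C ∧
          ∀ x, D.v₀ γ (deriv w x) * deriv (deriv w) x = C * D.J γs x) ∧
        D.IsStenzelPotential γ γs w := by
  intro s hs hsb
  have hc (β) (hβ : β ∈ D.rootsS) : 0 < exponent γs β :=
    mul_pos two_pos (hD.rootsS_pos hγ hβ)
  have h₀ := (isKEPotential_iff hc 0 _).1 (hu 0 ⟨le_rfl, hb_pos⟩)
  have hN0 : 0 < D.vCore γ 0 := h₀.core_pos hc continuous_vCore
  have hApos : (0 : ℝ) < (D.rootsS.card + 1) / D.vCore γ 0 := by positivity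
  set w := limitPotential D.rootsS (exponent γs) ((D.rootsS.card + 1) / D.vCore γ 0) with hw
  have hsmooth : ContDiff ℝ ∞ w := contDiff_limitPotential hc hApos
  have hκpos : 0 < ∏ β ∈ D.rootsS, killingDual (β : 𝔱 →ₗ[ℂ] ℂ) γ :=
    Finset.prod_pos fun β hβ => hD.killingDual_pos hγ hβ
  set C := (∏ β ∈ D.rootsS, killingDual (β : 𝔱 →ₗ[ℂ] ℂ) γ) / D.vCore γ 0 with hC
  have hCpos : 0 < C := by positivity
  have heq (x : ℝ) : D.v₀ γ (deriv w x) * deriv (deriv w) x = C * D.J γs x := by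
    have h := limitPotential_equation hc hApos x
    have hr : (0 : ℝ) < D.rootsS.card + 1 := by positivity
    have h' : deriv w x ^ D.rootsS.card * deriv (deriv w) x = D.J γs x / D.vCore γ 0 := by
      refine mul_left_cancel₀ hr.ne' ?_
      rw [← mul_assoc, h, J_eq]
      ring
    rw [v₀_eq, r, hC, mul_right_comm, h']
    ring
  refine ⟨id, strictMono_id, w, ?_, by exact_mod_cast contDiff_infty.1 hsmooth 2,
    limitPotential_even, ⟨C, hCpos, heq⟩, hsmooth, limitPotential_even,
    deriv_deriv_limitPotential_pos hc hApos, ⟨-(1 / 2) * Real.log C, fun x hx => ?_⟩,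
    tendsto_integral_sqrt_limitPotential hc hD.not_toral hApos⟩
  · exact tendstoLocallyUniformly_blowup hc hD.not_toral continuous_vCore h₀
      (u := fun n => u (s n)) (L := fun n => D.lambdaAc γs - s n)
      (fun n => (isKEPotential_iff hc _ _).1 (hu _ (hs n)))
      (fun n => by linarith [(hs n).1])
      (tendsto_apply_zero_atTop hD hγ hb_pos hb hu hs hsb)
  · have hJ : 0 < D.J γs x := sinhProd_pos hc hx
    have h : deriv (deriv w) x * ∏ β ∈ D.rootsS,
        killingDual (β : 𝔱 →ₗ[ℂ] ℂ) (((deriv w x : ℝ) : ℂ) • γ) /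
          Real.sinh (2 * (β γs).re * x) = C := by
      rw [Finset.prod_div_distrib]
      change deriv (deriv w) x * (D.v₀ γ (deriv w x) / D.J γs x) = C
      rw [← mul_div_assoc, mul_comm, heq x, mul_div_cancel_right₀ _ hJ.ne']
    rw [fiberRicciPotential, h]
end
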